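/- Let $m,d,k,d_C$ be integers with $d\ge 2$, $1\le k\le m$ and $1\le d_C\le d^m$, and let $\mathcal{H}=(\mathbb{C}^d)^{\otimes m}$ be the Hilbert space of $m$ parties of dimension $d$. For a set $S$ of parties and a unit vector $|\psi\rangle\in\mathcal{H}$, let $\psi_S=\mathrm{Tr}_{S^c}|\psi\rangle\langle\psi|$ be the reduced state on $S$, and let $\widetilde{\mathbb{1}}_S=\mathbb{1}_S/d^{|S|}$ be the maximally mixed state on $S$. For a subspace $\mathcal{H}_C\subseteq\mathcal{H}$ put $$\widetilde{\Lambda}^{\mathrm M}(\mathcal{H}_C,k)=\max_{S:\,|S|=k}\ \max_{|\psi\rangle\in\mathcal{H}_C,\ \|\psi\|=1}\ \bigl\|\psi_S-\widetilde{\mathbb{1}}_S\bigr\|_1 ,$$ where $\|\cdot\|_1$ is the trace norm. Let $\mathcal{H}_C$ be a random subspace of $\mathcal{H}$ of dimension $d_C$, that is, a random point of the Grassmannian of $d_C$-dimensional subspaces of $\mathcal{H}$ distributed according to the unitarily invariant probability measure. Then, for every real $\alpha>0$, $$\Pr\Bigl\{\widetilde{\Lambda}^{\mathrm M}(\mathcal{H}_C,k)\le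 d^{\,k-m/2}+\alpha\Bigr\}\ \ge\ 1-2\binom{m}{k}\Bigl(\frac{10}{\alpha}\Bigr)^{2d_C}\exp\Bigl(-\frac{d^m\alpha^2}{72\pi^3\ln 2}\Bigr).$$ -/

import Mathlib

open MeasureTheory

namespace QMask

noncomputable section

/-- The Hilbert space `(ℂ^d)^{⊗ m}` of `m` parties of dimension `d`, written in the product
(computational) basis, which is indexed by the words `x : Fin m → Fin d`. -/
abbrev H (m d : ℕ) : Type := EuclideanSpace ℂ (Fin m → Fin d)

/-- The word on all `m` parties which is `a` on the subsystem `S` and `c` on its complement. -/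
def glue {m d : ℕ} (S : Finset (Fin m)) (a : {i // i ∈ S} → Fin d)
    (c : {i // i ∉ S} → Fin d) : Fin m → Fin d :=
  fun i => if h : i ∈ S then a ⟨i, h⟩ else c ⟨i, h⟩

/-- The projector `|ψ⟩⟨ψ|`, as a matrix in the product basis. -/
def ketbra {m d : ℕ} (ψ : H m d) : Matrix (Fin m → Fin d) (Fin m → Fin d) ℂ :=
  Matrix.of fun x y => ψ x * star (ψ y)

/-- The partial trace over the complement of `S`. -/
def partialTrace {m d : ℕ} (S : Finset (Fin m))
    (ρ : Matrix (Fin m → Fin d) (Fin m → Fin d) ℂ) :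
    Matrix ({i // i ∈ S} → Fin d) ({i // i ∈ S} → Fin d) ℂ :=
  Matrix.of fun a b => ∑ c : {i // i ∉ S} → Fin d, ρ (glue S a c) (glue S b c)

/-- The reduced state of `|ψ⟩` on the subsystem `S`. -/
def reduced {m d : ℕ} (S : Finset (Fin m)) (ψ : H m d) :
    Matrix ({i // i ∈ S} → Fin d) ({i // i ∈ S} → Fin d) ℂ :=
  partialTrace S (ketbra ψ)

/-- The maximally mixed state on the subsystem `S`, whose dimension is `d ^ |S|`. -/
def maxMixed (m d : ℕ) (S : Finset (Fin m)) :
    Matrix ({i // i ∈ S} → Fin d) ({i // i ∈ S} → Fin d) ℂ :=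
  ((d : ℂ) ^ S.card)⁻¹ • 1

/-- The trace norm `‖A‖₁ = Tr √(A† A)`: the sum of the singular values of `A`. -/
def traceNorm {n : Type*} [Fintype n] [DecidableEq n] (A : Matrix n n ℂ) : ℝ :=
  ∑ i, Real.sqrt ((Matrix.isHermitian_conjTranspose_mul_self A).eigenvalues i)

/-- The trace distance, normalized without the factor `1 / 2`. -/
def traceDist {n : Type*} [Fintype n] [DecidableEq n] (ρ σ : Matrix n n ℂ) : ℝ :=
  traceNorm (ρ - σ)

/-- The maximum inaccuracy on the subsystem `S`, with respect to the maximally mixed state, of a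
set `𝒞` of pure states. -/
def inaccuracyOn {m d : ℕ} (𝒞 : Set (H m d)) (S : Finset (Fin m)) : ℝ :=
  ⨆ ψ : 𝒞, traceDist (reduced S (ψ : H m d)) (maxMixed m d S)

/-- The maximum subsystem inaccuracy of order `k`, with respect to the maximally mixed states, of a
set `𝒞` of pure states. -/
def inaccuracy {m d : ℕ} (𝒞 : Set (H m d)) (k : ℕ) : ℝ :=
  ⨆ S : {S : Finset (Fin m) // S.card = k}, inaccuracyOn 𝒞 (S : Finset (Fin m))

/-- The pure states (unit vectors) of a subspace. -/
def pureStates {m d : ℕ} (C : Submodule ℂ (H m d)) : Set (H m d) :=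
  {ψ | ψ ∈ C ∧ ‖ψ‖ = 1}

/-- The Grassmannian of the subspaces of dimension `dC` of `(ℂ^d)^{⊗ m}`. -/
def Gr (m d dC : ℕ) : Type :=
  {C : Submodule ℂ (H m d) // Module.finrank ℂ C = dC}

/-- The usual topology of the Grassmannian: that of the orthogonal projections. -/
instance Gr.topology (m d dC : ℕ) : TopologicalSpace (Gr m d dC) :=
  TopologicalSpace.induced (fun C => C.1.starProjection) inferInstance

instance Gr.measurable (m d dC : ℕ) : MeasurableSpace (Gr m d dC) := borel _

instance Gr.borel (m d dC : ℕ) : BorelSpace (Gr m d dC) := ⟨rfl⟩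

/-- The action of a unitary operator on subspaces. -/
def Gr.rotate {m d dC : ℕ} (U : H m d ≃ₗᵢ[ℂ] H m d) (C : Gr m d dC) : Gr m d dC :=
  ⟨C.1.map (U.toLinearEquiv : H m d →ₗ[ℂ] H m d),
    (LinearEquiv.finrank_map_eq U.toLinearEquiv C.1).trans C.2⟩

/-- The law of a (Haar) random subspace: a Borel probability measure on the Grassmannian that is
invariant under all unitary operators. -/
structure IsUniform {m d dC : ℕ} (μ : Measure (Gr m d dC)) : Prop where
  prob : IsProbabilityMeasure μ
  invariant : ∀ U : H m d ≃ₗᵢ[ℂ] H m d, μ.map (Gr.rotate U) = μ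

/-- The unitary group of `(ℂ^d)^{⊗ m}`. -/
abbrev UG (m d : ℕ) : Type := ↥(unitary (H m d →L[ℂ] H m d))


lemma Gr.continuous_rotate_left {m d dC : ℕ} (C : Gr m d dC) :
    Continuous (fun g : unitary (H m d →L[ℂ] H m d) =>
      Gr.rotate (Unitary.linearIsometryEquiv g) C) := by
  rw [continuous_induced_rng]
  have : ((fun C : Gr m d dC => C.1.starProjection) ∘ fun g : unitary (H m d →L[ℂ] H m d) =>
      Gr.rotate (Unitary.linearIsometryEquiv g) C)
      = fun g : unitary (H m d →L[ℂ] H m d) => (g : H m d →L[ℂ] H m d) * C.1.starProjection * star (g : H m d →L[ℂ] H m d) := by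
    funext g
    ext1 x
    have := Submodule.starProjection_map_apply (Unitary.linearIsometryEquiv g) C.1 x
    exact this
  rw [this]
  fun_prop

lemma Gr.continuous_rotate {m d dC : ℕ} (U : H m d ≃ₗᵢ[ℂ] H m d) :
    Continuous (Gr.rotate U : Gr m d dC → Gr m d dC) := by
  rw [continuous_induced_rng]
  have : ((fun C : Gr m d dC => C.1.starProjection) ∘ Gr.rotate U)
      = fun C => (U : H m d →L[ℂ] H m d) ∘L C.1.starProjection ∘L (U.symm : H m d →L[ℂ] H m d) := by
    funext C
    ext1 x
    have := Submodule.starProjection_map_apply U C.1 x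
    simpa [Gr.rotate] using this
  rw [this]
  have h : Continuous (fun C : Gr m d dC => C.1.starProjection) := continuous_induced_dom
  fun_prop

/-- The uniform law exists: it is the law of `U C₀`, where `C₀` is a fixed subspace and `U` is Haar
distributed on the unitary group. -/
theorem exists_isUniform {m d dC : ℕ} (h : dC ≤ d ^ m) :
    ∃ μ : Measure (Gr m d dC), IsUniform μ := by
  classical
  have : ContinuousStar (H m d →L[ℂ] H m d) :=
    ⟨(ContinuousLinearMap.adjoint (𝕜 := ℂ) (E := H m d) (F := H m d)).continuous⟩
  obtain ⟨W, hW⟩ : ∃ C : Submodule ℂ (H m d), Module.finrank ℂ C = dC := by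
    obtain ⟨f, hf⟩ := exists_linearIndependent_of_le_finrank (R := ℂ) (M := H m d) (n := dC)
      (by simpa using h)
    exact ⟨_, by simpa using finrank_span_eq_card hf⟩
  have : CompactSpace (UG m d) := by
    refine (isCompact_iff_compactSpace (s := ((unitary (H m d →L[ℂ] H m d) : Submonoid _) : Set (H m d →L[ℂ] H m d)))).mp ?_
    refine Metric.isCompact_of_isClosed_isBounded isClosed_unitary ?_
    refine (Metric.isBounded_closedBall (x := (0 : H m d →L[ℂ] H m d)) (r := 1)).subset ?_
    intro g hg
    rw [mem_closedBall_zero_iff]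
    refine ContinuousLinearMap.opNorm_le_bound _ zero_le_one fun x => ?_
    have := (Unitary.linearIsometryEquiv ⟨g, hg⟩).norm_map x
    rw [one_mul]
    exact this.le
  let : MeasurableSpace (UG m d) := borel _
  have : BorelSpace (UG m d) := ⟨rfl⟩
  have : IsTopologicalGroup (UG m d) := inferInstance
  let ν : Measure (UG m d) := Measure.haarMeasure ⊤
  have : IsProbabilityMeasure ν := ⟨by
    have := Measure.haarMeasure_self (G := UG m d) (K₀ := ⊤)
    simpa using this⟩
  have hc := Gr.continuous_rotate_left (m := m) (d := d) ⟨W, hW⟩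
  have : Measure.IsMulLeftInvariant ν := by dsimp [ν]; infer_instance
  refine ⟨ν.map (fun g => Gr.rotate (Unitary.linearIsometryEquiv g) ⟨W, hW⟩), ⟨?_, ?_⟩⟩
  · exact Measure.isProbabilityMeasure_map hc.measurable.aemeasurable
  · intro U
    rw [Measure.map_map (Gr.continuous_rotate U).measurable hc.measurable]
    conv_rhs => rw [← map_mul_left_eq_self ν (Unitary.linearIsometryEquiv.symm U)]
    rw [Measure.map_map hc.measurable (measurable_const_mul _)]
    congr 1
    funext g
    apply Subtype.ext
    simp only [Gr.rotate, Function.comp]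
    ext x
    simp
    rfl

end

end QMask

namespace QMask

noncomputable section

open ProbabilityTheory Real
open scoped NNReal ENNReal

/-! ### Gaussian concentration for Lipschitz functions -/

/-! Fix `S` with `|S| = k` and put `D = d ^ m`. The function to control is `deviation S y`, the
trace norm of the reduced operator of `y` minus `‖y‖²` times the maximally mixed state. The factor
`‖y‖²` makes it homogeneous of degree two on all of the Hilbert space, while on unit vectors it is
the trace distance of the theorem.

Mean. With `N = d ^ k`, Cauchy–Schwarz on singular values bounds the squared deviation by `N` times
the purity, minus one. The mean purity follows from the fourth moments of a unitarily invariant unit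
vector, and the mean squared deviation is at most `(N² - 1) / (D + 1) ≤ N² / D`. Jensen then bounds
the mean deviation by `d ^ (k - m / 2)` (`IsSphereLaw.lintegral_deviation_le`).

Concentration. Trace norm duality makes the deviation 4-Lipschitz on the unit ball
(`abs_deviation_sub_le_four`). Lévy's lemma (`sphere_concentration`) is derived from Gaussian space:
the Maurey–Pisier inequality applies to the deviation composed with a Lipschitz radial projection.
Independence of norm and direction transfers the tail to the sphere, at the cost of a factor 2. The
result is the bound `2 exp (-D s² / (32 π²))` for exceeding the mean bound by `s`.

From vectors to subspaces. An `α / 4`-net of the unit sphere of a fixed subspace is rotated by a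
Haar unitary. On unit vectors the deviation is 2-Lipschitz, so the net costs `α / 2` and
concentration is used with `s = α / 2` (`haarUG_rotate_mem_badSubspaces_le`). Any invariant law on
the Grassmannian is a mixture of such rotations (`IsUniform.measure_eq`), so its uniqueness is not
needed. A union bound over the subsystems of size `k` finishes. For `α > 2` the claim is trivial,
since the deviation of a unit vector never exceeds 2. -/

lemma pi_absolutelyContinuous {n : ℕ} (μ ν : Measure ℝ) [SigmaFinite μ] [SigmaFinite ν]
    (h : μ ≪ ν) : Measure.pi (fun _ : Fin n => μ) ≪ Measure.pi (fun _ : Fin n => ν) := by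
  induction n with
  | zero =>
    rw [Measure.pi_of_empty (fun _ : Fin 0 => μ), Measure.pi_of_empty (fun _ : Fin 0 => ν)]
  | succ n ih =>
    let e := MeasurableEquiv.piFinSuccAbove (fun _ : Fin (n + 1) => ℝ) 0
    have hμ := (measurePreserving_piFinSuccAbove (fun _ : Fin (n + 1) => μ) 0).symm e
    have hν := (measurePreserving_piFinSuccAbove (fun _ : Fin (n + 1) => ν) 0).symm e
    rw [← hμ.map_eq, ← hν.map_eq]
    exact (h.prod ih).map e.symm.measurable

section
variable {E : Type*} [NormedAddCommGroup E] [InnerProductSpace ℝ E] [FiniteDimensional ℝ E]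
  [MeasurableSpace E] [BorelSpace E]

/-- Rademacher's theorem in coordinates, transferred by absolute continuity of the Gaussian law with
respect to Lebesgue measure. -/
lemma stdGaussian_ae_differentiableAt {F : E → ℝ} {K : ℝ≥0} (hF : LipschitzWith K F) :
    ∀ᵐ x ∂(stdGaussian E), DifferentiableAt ℝ F x := by
  let e : (Fin (Module.finrank ℝ E) → ℝ) ≃L[ℝ] E :=
    ((PiLp.continuousLinearEquiv 2 ℝ fun _ : Fin (Module.finrank ℝ E) => ℝ).symm).trans
      (stdOrthonormalBasis ℝ E).repr.symm.toContinuousLinearEquiv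
  have he : ∀ x, e x = ∑ i, x i • stdOrthonormalBasis ℝ E i := by
    intro x
    simp [e, ← OrthonormalBasis.sum_repr_symm]
  have hG : LipschitzWith _ (F ∘ e) := hF.comp e.lipschitz
  have h1 : ∀ᵐ x ∂(Measure.pi fun _ : Fin (Module.finrank ℝ E) => gaussianReal 0 1),
      DifferentiableAt ℝ (F ∘ e) x :=
    (pi_absolutelyContinuous _ volume (gaussianReal_absolutelyContinuous 0 one_ne_zero)).ae_le
      (hG.ae_differentiableAt (μ := volume))
  rw [stdGaussian, ae_map_iff (Measurable.aemeasurable (by fun_prop))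
    (measurableSet_of_differentiableAt ℝ F)]
  filter_upwards [h1] with x hx
  rw [← he]
  exact (e.comp_right_differentiableAt_iff (f := F)).mp hx

lemma lintegral_exp_stdGaussian (L : StrongDual ℝ E) :
    ∫⁻ y, ENNReal.ofReal (exp (L y)) ∂(stdGaussian E) = ENNReal.ofReal (exp (‖L‖ ^ 2 / 2)) := by
  have h := IsGaussian.map_eq_gaussianReal (μ := stdGaussian E) L
  rw [variance_dual_stdGaussian, integral_strongDual_stdGaussian] at h
  have hi : Integrable (fun x => exp (1 * x)) ((stdGaussian E).map L) := by
    rw [h]; exact integrable_exp_mul_gaussianReal 1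
  have hm := mgf_gaussianReal h 1
  simp only [mgf, one_mul] at hm hi
  have hi' : Integrable (fun x => exp (L x)) (stdGaussian E) :=
    (integrable_map_measure (f := L) (g := fun x => exp x) (by fun_prop) (by fun_prop)).mp hi
  rw [← ofReal_integral_eq_lintegral_ofReal hi' (Filter.Eventually.of_forall fun _ => (exp_pos _).le),
    hm]
  congr 2
  rw [Real.coe_toNNReal _ (by positivity)]
  ring

lemma measurable_fderiv_apply (F : E → ℝ) :
    Measurable fun q : E × E => fderiv ℝ F q.1 q.2 := by
  have h1 : Measurable fun q : E × E => fderiv ℝ F q.1 := (measurable_fderiv ℝ F).comp measurable_fst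
  exact (isBoundedBilinearMap_apply (𝕜 := ℝ) (E := E) (F := ℝ)).continuous.measurable.comp (h1.prodMk measurable_snd)

/-- The quarter circle `cos (π s / 2) x + sin (π s / 2) y` joins `x` to `y`, and its velocity is `π
/ 2` times the second component of the rotated pair. The increment of `F` is the integral of its
derivative along this arc, and Jensen moves the exponential inside. -/
lemma exp_sub_le_lintegral {F : E → ℝ} {K : ℝ≥0} (hF : LipschitzWith K F) (t : ℝ) (p : E × E)
    (hp : ∀ᵐ s ∂(volume.restrict (Set.Ioc (0 : ℝ) 1)),
      DifferentiableAt ℝ F (ContinuousLinearMap.rotation (π / 2 * s) p).1) :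
    ENNReal.ofReal (exp (t * (F p.2 - F p.1))) ≤
      ∫⁻ s in Set.Ioc (0 : ℝ) 1, ENNReal.ofReal (exp (t * (π / 2) *
        fderiv ℝ F (ContinuousLinearMap.rotation (π / 2 * s) p).1
          (ContinuousLinearMap.rotation (π / 2 * s) p).2)) := by
  have hprob : IsProbabilityMeasure (volume.restrict (Set.Ioc (0 : ℝ) 1)) := ⟨by simp⟩
  set H : ℝ → ℝ := fun s => t * (π / 2) * fderiv ℝ F (ContinuousLinearMap.rotation (π / 2 * s) p).1
          (ContinuousLinearMap.rotation (π / 2 * s) p).2 with hH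
  let X : ℝ → E := fun s => (ContinuousLinearMap.rotation (π / 2 * s) p).1
  have hXd : ∀ s, HasDerivAt X ((π / 2) • (ContinuousLinearMap.rotation (π / 2 * s) p).2) s := by
    intro s
    simp only [X, ContinuousLinearMap.rotation_apply]
    have h0 : HasDerivAt (fun s : ℝ => π / 2 * s) (π / 2) s := by
      simpa using (hasDerivAt_id s).const_mul (π / 2)
    have h1 := (h0.cos.smul_const p.1).add (h0.sin.smul_const p.2)
    convert! h1 using 1
    rw [smul_add, smul_smul, smul_smul]
    congr 2 <;> ring
  have hXc : ContDiff ℝ 1 X := by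
    simp only [X, ContinuousLinearMap.rotation_apply]
    fun_prop
  obtain ⟨C, hC⟩ := (hXc.contDiffOn (s := Set.uIcc 0 1)).exists_lipschitzOnWith (by decide)
    (convex_Icc _ _) isCompact_Icc
  -- A Lipschitz function along a smooth arc is absolutely continuous, so differentiability at
  -- almost every time suffices for the fundamental theorem of calculus.
  have hac := (hF.comp_lipschitzOnWith hC).absolutelyContinuousOnInterval.integral_deriv_eq_sub
  have hX0 : X 0 = p.1 := by simp [X, ContinuousLinearMap.rotation_apply]
  have hX1 : X 1 = p.2 := by simp [X, ContinuousLinearMap.rotation_apply]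
  have hae : ∀ᵐ s ∂(volume.restrict (Set.Ioc (0 : ℝ) 1)), t * deriv (F ∘ X) s = H s := by
    filter_upwards [hp] with s hs
    have := (hs.hasFDerivAt.comp_hasDerivAt s (hXd s)).deriv
    rw [this]
    simp only [H, map_smul, smul_eq_mul]
    ring
  rw [Function.comp, Function.comp, hX0, hX1, intervalIntegral.integral_of_le zero_le_one] at hac
  have hint : ∫ s in Set.Ioc (0 : ℝ) 1, H s = t * (F p.2 - F p.1) := by
    rw [← hac, ← integral_const_mul]
    exact (integral_congr_ae hae).symm
  have hrm : Measurable fun s : ℝ => ContinuousLinearMap.rotation (π / 2 * s) p := by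
    simp only [ContinuousLinearMap.rotation_apply]
    fun_prop
  have hHm : Measurable H := ((measurable_fderiv_apply F).comp hrm).const_mul _
  have hHb : ∀ s, ‖H s‖ ≤ |t * (π / 2)| * (K * (‖p.1‖ + ‖p.2‖)) := by
    intro s
    rw [hH, norm_mul, Real.norm_eq_abs]
    gcongr
    refine (ContinuousLinearMap.le_opNorm _ _).trans ?_
    gcongr
    · exact norm_fderiv_le_of_lipschitz ℝ hF
    · rw [ContinuousLinearMap.rotation_apply]
      refine (norm_add_le _ _).trans ?_
      rw [norm_smul, norm_smul]
      refine add_le_add (mul_le_of_le_one_left (norm_nonneg _) ?_)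
        (mul_le_of_le_one_left (norm_nonneg _) ?_)
      · rw [norm_neg]; exact abs_sin_le_one _
      · exact abs_cos_le_one _
  have hHi : Integrable H (volume.restrict (Set.Ioc (0 : ℝ) 1)) :=
    Integrable.of_bound hHm.aestronglyMeasurable _ (Filter.Eventually.of_forall hHb)
  have hEi : Integrable (exp ∘ H) (volume.restrict (Set.Ioc (0 : ℝ) 1)) := by
    refine Integrable.of_bound (measurable_exp.comp hHm).aestronglyMeasurable
      (exp (|t * (π / 2)| * (K * (‖p.1‖ + ‖p.2‖)))) (Filter.Eventually.of_forall fun s => ?_)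
    simp only [Function.comp, Real.norm_eq_abs, abs_exp]
    exact exp_le_exp.mpr ((le_abs_self _).trans (hHb s))
  have hJ := convexOn_exp.map_integral_le (μ := volume.restrict (Set.Ioc (0 : ℝ) 1))
    continuous_exp.continuousOn isClosed_univ (Filter.Eventually.of_forall fun _ => Set.mem_univ _)
    hHi hEi
  rw [hint] at hJ
  refine (ENNReal.ofReal_le_ofReal hJ).trans_eq ?_
  exact ofReal_integral_eq_lintegral_ofReal hEi
    (Filter.Eventually.of_forall fun _ => (exp_pos _).le)

/-- The inequality of Maurey and Pisier. -/
lemma lintegral_exp_sub_le {F : E → ℝ} {K : ℝ≥0} (hF : LipschitzWith K F) (t : ℝ) :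
    ∫⁻ p, ENNReal.ofReal (exp (t * (F p.2 - F p.1))) ∂((stdGaussian E).prod (stdGaussian E)) ≤
      ENNReal.ofReal (exp (t ^ 2 * π ^ 2 * K ^ 2 / 8)) := by
  set γ := stdGaussian E
  have hprob : IsProbabilityMeasure (volume.restrict (Set.Ioc (0 : ℝ) 1)) := ⟨by simp⟩
  have hrot : ∀ θ : ℝ, MeasurePreserving (ContinuousLinearMap.rotation θ : E × E →L[ℝ] E × E)
      (γ.prod γ) (γ.prod γ) := fun θ =>
    ⟨by fun_prop, IsGaussian.map_rotation_eq_self (by simpa using integral_id_stdGaussian) θ⟩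
  have hscale : Measurable fun q : (E × E) × ℝ => ContinuousLinearMap.rotation (π / 2 * q.2) q.1 := by
    simp only [ContinuousLinearMap.rotation_apply]
    fun_prop
  -- By Fubini it suffices to fix `s`; then rotation invariance reduces the claim to almost
  -- everywhere differentiability at the first component.
  have hdiff : ∀ᵐ p ∂(γ.prod γ), ∀ᵐ s ∂(volume.restrict (Set.Ioc (0 : ℝ) 1)),
      DifferentiableAt ℝ F (ContinuousLinearMap.rotation (π / 2 * s) p).1 := by
    have hms : MeasurableSet {q : (E × E) × ℝ |
        DifferentiableAt ℝ F (ContinuousLinearMap.rotation (π / 2 * q.2) q.1).1} :=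
      (measurable_fst.comp hscale) (measurableSet_of_differentiableAt ℝ F)
    refine (Measure.ae_ae_comm (μ := γ.prod γ)
      (p := fun p s => DifferentiableAt ℝ F (ContinuousLinearMap.rotation (π / 2 * s) p).1) hms).mpr ?_
    refine Filter.Eventually.of_forall fun s => ?_
    have h1 : ∀ᵐ p ∂(γ.prod γ), DifferentiableAt ℝ F p.1 :=
      Measure.quasiMeasurePreserving_fst.ae (stdGaussian_ae_differentiableAt hF)
    exact (hrot _).quasiMeasurePreserving.ae h1
  have hGm : Measurable fun q : E × E => ENNReal.ofReal (exp (t * (π / 2) * fderiv ℝ F q.1 q.2)) :=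
    (((measurable_fderiv_apply F).const_mul _).exp).ennreal_ofReal
  calc _ ≤ ∫⁻ p, (∫⁻ s in Set.Ioc (0 : ℝ) 1, ENNReal.ofReal (exp (t * (π / 2) *
        fderiv ℝ F (ContinuousLinearMap.rotation (π / 2 * s) p).1
          (ContinuousLinearMap.rotation (π / 2 * s) p).2))) ∂(γ.prod γ) := by
        refine lintegral_mono_ae ?_
        filter_upwards [hdiff] with p hp
        exact exp_sub_le_lintegral hF t p hp
    _ = ∫⁻ s in Set.Ioc (0 : ℝ) 1, ∫⁻ p, ENNReal.ofReal (exp (t * (π / 2) *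
        fderiv ℝ F (ContinuousLinearMap.rotation (π / 2 * s) p).1
          (ContinuousLinearMap.rotation (π / 2 * s) p).2)) ∂(γ.prod γ) :=
        lintegral_lintegral_swap (hGm.comp hscale).aemeasurable
    _ = ∫⁻ s in Set.Ioc (0 : ℝ) 1, ∫⁻ q, ENNReal.ofReal (exp (t * (π / 2) *
        fderiv ℝ F q.1 q.2)) ∂(γ.prod γ) := by
        refine lintegral_congr fun s => ?_
        exact (hrot _).lintegral_comp hGm
    _ = ∫⁻ q, ENNReal.ofReal (exp (t * (π / 2) * fderiv ℝ F q.1 q.2)) ∂(γ.prod γ) := by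
        simp
    _ = ∫⁻ x, ∫⁻ y, ENNReal.ofReal (exp (t * (π / 2) * fderiv ℝ F x y)) ∂γ ∂γ :=
        lintegral_prod _ hGm.aemeasurable
    _ ≤ ∫⁻ x, ENNReal.ofReal (exp (t ^ 2 * π ^ 2 * K ^ 2 / 8)) ∂γ := by
        refine lintegral_mono fun x => ?_
        have := lintegral_exp_stdGaussian ((t * (π / 2)) • fderiv ℝ F x)
        simp only [FunLike.coe_smul, Pi.smul_apply, smul_eq_mul] at this
        rw [this]
        refine ENNReal.ofReal_le_ofReal (exp_le_exp.mpr ?_)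
        rw [norm_smul, mul_pow, Real.norm_eq_abs, sq_abs]
        have hK : ‖fderiv ℝ F x‖ ^ 2 ≤ (K : ℝ) ^ 2 :=
          pow_le_pow_left₀ (norm_nonneg _) (norm_fderiv_le_of_lipschitz ℝ hF) 2
        have := mul_le_mul_of_nonneg_left hK (sq_nonneg (t * (π / 2)))
        nlinarith
    _ = _ := by simp

/-- Jensen in the independent copy replaces it by the mean. -/
lemma integral_exp_sub_mean_le {F : E → ℝ} {K : ℝ≥0} (hF : LipschitzWith K F) {B : ℝ}
    (hB : ∀ x, |F x| ≤ B) (t : ℝ) :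
    ∫ y, exp (t * (F y - ∫ x, F x ∂(stdGaussian E))) ∂(stdGaussian E) ≤
      exp (t ^ 2 * π ^ 2 * K ^ 2 / 8) := by
  set γ := stdGaussian E
  have hFm : Measurable F := hF.continuous.measurable
  have hFi : Integrable F γ := Integrable.of_bound hFm.aestronglyMeasurable B
    (Filter.Eventually.of_forall hB)
  have hI2 : Integrable (fun p : E × E => exp (t * (F p.2 - F p.1))) (γ.prod γ) := by
    refine Integrable.of_bound (by fun_prop) (exp (|t| * (B + B)))
      (Filter.Eventually.of_forall fun p => ?_)
    rw [Real.norm_eq_abs, abs_exp, exp_le_exp]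
    refine (le_abs_self _).trans ?_
    rw [abs_mul]
    gcongr
    exact (abs_sub _ _).trans (add_le_add (hB _) (hB _))
  have hle : ∫ p, exp (t * (F p.2 - F p.1)) ∂(γ.prod γ) ≤ exp (t ^ 2 * π ^ 2 * K ^ 2 / 8) := by
    have h := lintegral_exp_sub_le hF t
    rw [← ofReal_integral_eq_lintegral_ofReal hI2
      (Filter.Eventually.of_forall fun _ => (exp_pos _).le)] at h
    exact (ENNReal.ofReal_le_ofReal_iff (exp_pos _).le).mp h
  refine le_trans ?_ hle
  rw [integral_prod_symm _ hI2]
  refine integral_mono_of_nonneg (Filter.Eventually.of_forall fun _ => (exp_pos _).le)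
    hI2.integral_prod_right (Filter.Eventually.of_forall fun y => ?_)
  have hi1 : Integrable (fun x => t * (F y - F x)) γ := ((integrable_const _).sub hFi).const_mul t
  have hi2 : Integrable (fun x => exp (t * (F y - F x))) γ := by
    refine Integrable.of_bound (by fun_prop) (exp (|t| * (B + B)))
      (Filter.Eventually.of_forall fun x => ?_)
    rw [Real.norm_eq_abs, abs_exp, exp_le_exp]
    refine (le_abs_self _).trans ?_
    rw [abs_mul]
    gcongr
    exact (abs_sub _ _).trans (add_le_add (hB _) (hB _))
  have hJ := convexOn_exp.map_integral_le (μ := γ) continuous_exp.continuousOn isClosed_univ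
    (Filter.Eventually.of_forall fun _ => Set.mem_univ _) hi1 hi2
  rw [integral_const_mul, integral_sub (integrable_const _) hFi] at hJ
  simpa using hJ

/-- Gaussian concentration of a bounded Lipschitz function around its mean. -/
lemma stdGaussian_concentration {F : E → ℝ} {K : ℝ≥0} (hF : LipschitzWith K F) (hK : 0 < K) {B : ℝ}
    (hB : ∀ x, |F x| ≤ B) {s : ℝ} (hs : 0 ≤ s) :
    (stdGaussian E).real {x | (∫ x, F x ∂(stdGaussian E)) + s ≤ F x} ≤
      exp (-(2 * s ^ 2 / (π ^ 2 * K ^ 2))) := by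
  set γ := stdGaussian E
  set M := ∫ x, F x ∂γ with hM
  have hFm : Measurable F := hF.continuous.measurable
  have hK' : (0 : ℝ) < K := hK
  -- The minimiser of the Chernoff exponent `-t s + t² π² K² / 8`.
  set t : ℝ := 4 * s / (π ^ 2 * K ^ 2) with ht
  have hint : Integrable (fun x => exp (t * (F x - M))) γ := by
    refine Integrable.of_bound (by fun_prop) (exp (|t| * (B + |M|)))
      (Filter.Eventually.of_forall fun p => ?_)
    rw [Real.norm_eq_abs, abs_exp, exp_le_exp]
    refine (le_abs_self _).trans ?_
    rw [abs_mul]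
    gcongr
    exact (abs_sub _ _).trans (by gcongr; exact hB _)
  have h := measure_ge_le_exp_mul_mgf (μ := γ) (X := fun x => F x - M) (t := t) s (by positivity) hint
  have hset : {x | M + s ≤ F x} = {x | s ≤ F x - M} := by
    ext x; simp only [Set.mem_ofPred_eq]; constructor <;> intro h <;> linarith
  rw [hset]
  refine h.trans ?_
  refine (mul_le_mul_of_nonneg_left (integral_exp_sub_mean_le hF hB t) (exp_pos _).le).trans_eq ?_
  rw [← exp_add]
  congr 1
  rw [ht]
  field_simp
  ring

end

/-! ### The norm of a standard Gaussian vector -/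

lemma integral_exp_neg_sq_gaussianReal :
    ∫ x, exp (-(x ^ 2) / 2) ∂(gaussianReal 0 1) = (√2)⁻¹ := by
  rw [integral_gaussianReal_eq_integral_smul one_ne_zero]
  have h : ∀ x : ℝ, gaussianPDFReal 0 1 x • exp (-(x ^ 2) / 2) = (√(2 * π))⁻¹ * exp (-1 * x ^ 2) := by
    intro x
    simp only [gaussianPDFReal, NNReal.coe_one, mul_one, sub_zero, smul_eq_mul]
    rw [mul_assoc, ← exp_add]
    congr 2
    ring
  simp_rw [h]
  rw [integral_const_mul, integral_gaussian, sqrt_mul (by norm_num)]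
  have : √π ≠ 0 := by positivity
  field_simp

section
variable {E : Type*} [NormedAddCommGroup E] [InnerProductSpace ℝ E] [FiniteDimensional ℝ E]
  [MeasurableSpace E] [BorelSpace E]

lemma integral_exp_neg_norm_sq_stdGaussian :
    ∫ x, exp (-‖x‖ ^ 2 / 2) ∂(stdGaussian E) = (√2)⁻¹ ^ (Module.finrank ℝ E) := by
  rw [stdGaussian, integral_map (Measurable.aemeasurable (by fun_prop))
    (Measurable.aestronglyMeasurable (by fun_prop))]
  have h : ∀ x : Fin (Module.finrank ℝ E) → ℝ,
      exp (-‖∑ i, x i • stdOrthonormalBasis ℝ E i‖ ^ 2 / 2) = ∏ i, exp (-(x i ^ 2) / 2) := by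
    intro x
    rw [← exp_sum]
    congr 1
    rw [← Finset.sum_div, Finset.sum_neg_distrib]
    congr 2
    have := (stdOrthonormalBasis ℝ E).orthonormal.inner_sum x x Finset.univ
    rw [← real_inner_self_eq_norm_sq, this]
    simp [pow_two]
  simp_rw [h]
  rw [integral_fintype_prod_eq_prod (fun _ x => exp (-(x ^ 2) / 2))]
  simp [integral_exp_neg_sq_gaussianReal]

/-- A Chernoff bound: `‖x‖² ≤ n / 8` has probability at most `e ^ (n / 16) 2 ^ (-n / 2)`, which is
below one half for `n ≥ 4`. -/
lemma half_le_stdGaussian_norm_ge (hn : 4 ≤ Module.finrank ℝ E) :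
    1 / 2 ≤ (stdGaussian E).real {x | √(Module.finrank ℝ E / 8) ≤ ‖x‖} := by
  set γ := stdGaussian E
  set n := Module.finrank ℝ E
  have hn' : (4 : ℝ) ≤ n := by exact_mod_cast hn
  have hint : Integrable (fun x : E => exp (1 * (-‖x‖ ^ 2 / 2))) γ := by
    refine Integrable.of_bound (Measurable.aestronglyMeasurable (by fun_prop)) 1
      (Filter.Eventually.of_forall fun x => ?_)
    rw [Real.norm_eq_abs, abs_exp, exp_le_one_iff]
    have := sq_nonneg ‖x‖
    linarith
  have h := measure_ge_le_exp_mul_mgf (μ := γ) (X := fun x : E => -‖x‖ ^ 2 / 2) (t := 1)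
    (-(n / 16)) zero_le_one hint
  simp only [mgf, one_mul, γ, integral_exp_neg_norm_sq_stdGaussian] at h
  have hb : exp (-1 * -(n / 16 : ℝ)) * (√2)⁻¹ ^ n ≤ 1 / 2 := by
    have h2 : (√2)⁻¹ = exp (-(log 2 / 2)) := by
      rw [exp_neg, sqrt_eq_rpow, rpow_def_of_pos (by norm_num)]
      congr 3; ring
    rw [h2, ← exp_nat_mul, ← exp_add]
    have : (1 / 2 : ℝ) = exp (-log 2) := by rw [exp_neg, exp_log (by norm_num)]; norm_num
    rw [this, exp_le_exp]
    have := Real.log_two_gt_d9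
    nlinarith
  have hcompl : {x : E | √(n / 8) ≤ ‖x‖}ᶜ ⊆ {x : E | -(n / 16 : ℝ) ≤ -‖x‖ ^ 2 / 2} := by
    intro x hx
    simp only [Set.mem_compl_iff, Set.mem_ofPred_eq, not_le] at hx ⊢
    have := (Real.lt_sqrt (norm_nonneg x)).mp hx
    linarith
  have h1 : γ.real {x : E | √(n / 8) ≤ ‖x‖}ᶜ ≤ 1 / 2 :=
    (measureReal_mono hcompl).trans (h.trans hb)
  have hm : MeasurableSet {x : E | √(n / 8) ≤ ‖x‖} := measurableSet_le measurable_const measurable_norm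
  rw [probReal_compl_eq_one_sub hm] at h1
  linarith

/-! ### Radial projection onto the unit ball -/

/-- The radial projection onto the ball of radius `r`, rescaled to the unit ball. -/
def radialProj (r : ℝ) (x : E) : E := (max ‖x‖ r)⁻¹ • x

omit [FiniteDimensional ℝ E] [MeasurableSpace E] [BorelSpace E] in
lemma norm_radialProj_le {r : ℝ} (hr : 0 < r) (x : E) : ‖radialProj r x‖ ≤ 1 := by
  have : 0 < max ‖x‖ r := lt_max_of_lt_right hr
  rw [radialProj, norm_smul, norm_inv, Real.norm_of_nonneg this.le, inv_mul_le_one₀ this]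
  exact le_max_left _ _

lemma sq_div_max_le {a b r : ℝ} (hr : 0 < r) (ha : 0 ≤ a) (hab : a ≤ b) :
    a ^ 2 / max a r ≤ b ^ 2 / max b r := by
  have hA : 0 < max a r := lt_max_of_lt_right hr
  have hB : 0 < max b r := lt_max_of_lt_right hr
  rw [div_le_div_iff₀ hA hB]
  rcases le_total a r with h1 | h1 <;> rcases le_total b r with h2 | h2 <;>
    simp only [max_eq_left, max_eq_right, h1, h2]
  · gcongr
  · have hb : 0 ≤ b := ha.trans hab
    have : a * (a * b) ≤ r * (b * b) := mul_le_mul h1 (by nlinarith) (by positivity) hr.le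
    nlinarith
  · have h3 : a = r := le_antisymm (hab.trans h2) h1
    subst h3
    gcongr
  · have : a * b * a ≤ a * b * b := mul_le_mul_of_nonneg_left hab (by nlinarith)
    nlinarith

omit [FiniteDimensional ℝ E] [MeasurableSpace E] [BorelSpace E] in
-- With `A = max ‖x‖ r` and `B = max ‖y‖ r`, the difference `‖x - y‖² / (A B) - ‖x / A - y / B‖²`
-- equals `(1 / B - 1 / A) (‖x‖² / A - ‖y‖² / B)`. Both factors have the same sign, by monotonicity
-- of `a² / max a r`.
lemma norm_radialProj_sub_le {r : ℝ} (hr : 0 < r) (x y : E) :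
    ‖radialProj r x - radialProj r y‖ ≤ r⁻¹ * ‖x - y‖ := by
  have hA : 0 < max ‖x‖ r := lt_max_of_lt_right hr
  have hB : 0 < max ‖y‖ r := lt_max_of_lt_right hr
  have hAr : r ≤ max ‖x‖ r := le_max_right _ _
  have hBr : r ≤ max ‖y‖ r := le_max_right _ _
  have hkey : 0 ≤ ((max ‖y‖ r)⁻¹ - (max ‖x‖ r)⁻¹) *
      (‖x‖ ^ 2 / max ‖x‖ r - ‖y‖ ^ 2 / max ‖y‖ r) := by
    rcases le_total ‖x‖ ‖y‖ with h | h
    · refine mul_nonneg_of_nonpos_of_nonpos ?_ (sub_nonpos.mpr (sq_div_max_le hr (norm_nonneg _) h))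
      exact sub_nonpos.mpr (inv_anti₀ hA (max_le_max_right r h))
    · refine mul_nonneg ?_ (sub_nonneg.mpr (sq_div_max_le hr (norm_nonneg _) h))
      exact sub_nonneg.mpr (inv_anti₀ hB (max_le_max_right r h))
  refine abs_le_of_sq_le_sq' ?_ (by positivity) |>.2
  rw [mul_pow, norm_sub_sq_real, norm_sub_sq_real, radialProj, radialProj, norm_smul, norm_smul,
    real_inner_smul_left, real_inner_smul_right, norm_inv, norm_inv, Real.norm_of_nonneg hA.le,
    Real.norm_of_nonneg hB.le]
  set A := max ‖x‖ r
  set B := max ‖y‖ r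
  have h1 : A⁻¹ * B⁻¹ * (‖x‖ ^ 2 - 2 * inner ℝ x y + ‖y‖ ^ 2) ≤
      r⁻¹ ^ 2 * (‖x‖ ^ 2 - 2 * inner ℝ x y + ‖y‖ ^ 2) := by
    rw [← norm_sub_sq_real, pow_two r⁻¹]
    gcongr
  refine le_trans ?_ h1
  have : A⁻¹ * B⁻¹ * (‖x‖ ^ 2 - 2 * inner ℝ x y + ‖y‖ ^ 2) -
    ((A⁻¹ * ‖x‖) ^ 2 - 2 * (A⁻¹ * (B⁻¹ * inner ℝ x y)) + (B⁻¹ * ‖y‖) ^ 2) =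
      (B⁻¹ - A⁻¹) * (‖x‖ ^ 2 / A - ‖y‖ ^ 2 / B) := by
    field_simp
    ring
  linarith

/-! ### Concentration on the sphere -/

/-- The radial and the angular part of a Gaussian vector are independent, and the angular part has
the law `κ` of a random rotation of any unit vector. -/
lemma lintegral_radial_mul_angular {Ω : Type*} [MeasurableSpace Ω] {ν : Measure Ω}
    [IsProbabilityMeasure ν] {U : Ω → E → E} (hUm : Measurable fun p : Ω × E => U p.1 p.2)
    (hUp : ∀ ω, (stdGaussian E).map (U ω) = stdGaussian E)
    (hUn : ∀ ω x, ‖U ω x‖ = ‖x‖) (hUs : ∀ ω (c : ℝ) x, U ω (c • x) = c • U ω x)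
    {κ : Measure E} (hκ : ∀ ψ : E, ‖ψ‖ = 1 → ν.map (fun ω => U ω ψ) = κ)
    {w : ℝ → ℝ≥0∞} (hw : Measurable w) (hw0 : w 0 = 0) {h : E → ℝ≥0∞} (hh : Measurable h) :
    ∫⁻ x, w ‖x‖ * h (‖x‖⁻¹ • x) ∂(stdGaussian E) =
      (∫⁻ x, w ‖x‖ ∂(stdGaussian E)) * ∫⁻ x, h x ∂κ := by
  set γ := stdGaussian E
  have hUω : ∀ ω, Measurable (U ω) := fun ω => hUm.comp measurable_prodMk_left
  have hUx : ∀ x, Measurable fun ω => U ω x := fun x => hUm.comp measurable_prodMk_right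
  have hm : Measurable fun x : E => w ‖x‖ * h (‖x‖⁻¹ • x) :=
    (hw.comp measurable_norm).mul (hh.comp (by fun_prop))
  have hrot : ∀ ω, ∫⁻ x, w ‖x‖ * h (‖x‖⁻¹ • x) ∂γ = ∫⁻ x, w ‖x‖ * h (U ω (‖x‖⁻¹ • x)) ∂γ := by
    intro ω
    conv_lhs => rw [← hUp ω, lintegral_map hm (hUω ω)]
    simp only [hUn, hUs, γ]
  calc ∫⁻ x, w ‖x‖ * h (‖x‖⁻¹ • x) ∂γ
      = ∫⁻ _ω, (∫⁻ x, w ‖x‖ * h (‖x‖⁻¹ • x) ∂γ) ∂ν := by simp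
    _ = ∫⁻ ω, (∫⁻ x, w ‖x‖ * h (U ω (‖x‖⁻¹ • x)) ∂γ) ∂ν := lintegral_congr hrot
    _ = ∫⁻ x, (∫⁻ ω, w ‖x‖ * h (U ω (‖x‖⁻¹ • x)) ∂ν) ∂γ := by
        refine lintegral_lintegral_swap (Measurable.aemeasurable ?_)
        refine (hw.comp (measurable_norm.comp measurable_snd)).mul (hh.comp ?_)
        exact hUm.comp (measurable_fst.prodMk
          ((by fun_prop : Measurable fun x : E => ‖x‖⁻¹ • x).comp measurable_snd))
    _ = ∫⁻ x, w ‖x‖ * (∫⁻ y, h y ∂κ) ∂γ := by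
        refine lintegral_congr fun x => ?_
        rw [lintegral_const_mul _ (f := fun ω => h (U ω (‖x‖⁻¹ • x))) (hh.comp (hUx _))]
        -- The origin has no direction; `hw0` gives it weight zero.
        rcases eq_or_ne x 0 with rfl | hx
        · simp [hw0]
        · rw [← hκ (‖x‖⁻¹ • x) (norm_smul_inv_norm hx), lintegral_map hh (hUx _)]
    _ = _ := lintegral_mul_const _ (hw.comp measurable_norm)

/-- Lévy's lemma, for a function which is homogeneous of degree two. -/
lemma sphere_concentration {Ω : Type*} [MeasurableSpace Ω] {ν : Measure Ω}
    [IsProbabilityMeasure ν] {U : Ω → E → E} (hUm : Measurable fun p : Ω × E => U p.1 p.2)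
    (hUp : ∀ ω, (stdGaussian E).map (U ω) = stdGaussian E)
    (hUn : ∀ ω x, ‖U ω x‖ = ‖x‖) (hUs : ∀ ω (c : ℝ) x, U ω (c • x) = c • U ω x)
    {κ : Measure E} (hκ : ∀ ψ : E, ‖ψ‖ = 1 → ν.map (fun ω => U ω ψ) = κ)
    (hn : 4 ≤ Module.finrank ℝ E)
    {f : E → ℝ} (hf0 : ∀ x, 0 ≤ f x) (hfs : ∀ (c : ℝ) x, f (c • x) = c ^ 2 * f x)
    (hfc : Continuous f)
    (hfl : ∀ x y, ‖x‖ ≤ 1 → ‖y‖ ≤ 1 → |f x - f y| ≤ 4 * ‖x - y‖)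
    {M : ℝ} (hM0 : 0 ≤ M) (hM : ∫⁻ x, ENNReal.ofReal (f x) ∂κ ≤ ENNReal.ofReal M)
    {s : ℝ} (hs : 0 ≤ s) :
    κ {x | M + s ≤ f x} ≤
      ENNReal.ofReal (2 * exp (-(Module.finrank ℝ E * s ^ 2 / (64 * π ^ 2)))) := by
  set γ := stdGaussian E
  set n := Module.finrank ℝ E
  have hn' : (4 : ℝ) ≤ n := by exact_mod_cast hn
  set r : ℝ := √(n / 8) with hr_def
  have hr : 0 < r := sqrt_pos.mpr (by linarith)
  have hr2 : r ^ 2 = n / 8 := sq_sqrt (by linarith)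
  have hf00 : f 0 = 0 := by simpa using hfs 0 0
  let F : E → ℝ := fun x => f (radialProj r x)
  let K : ℝ≥0 := ⟨4 / r, by positivity⟩
  have hKpos : 0 < K := by
    have : (0 : ℝ) < K := by change 0 < 4 / r; positivity
    exact_mod_cast this
  have hF : LipschitzWith K F := by
    refine LipschitzWith.of_dist_le_mul fun x y => ?_
    rw [Real.dist_eq, dist_eq_norm]
    refine (hfl _ _ (norm_radialProj_le hr x) (norm_radialProj_le hr y)).trans ?_
    change _ ≤ 4 / r * _
    have := norm_radialProj_sub_le hr x y
    rw [div_eq_mul_inv, mul_assoc]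
    gcongr
  have hFb : ∀ x, |F x| ≤ 4 := by
    intro x
    have h := hfl _ 0 (norm_radialProj_le hr x) (by simp)
    rw [hf00, sub_zero, sub_zero] at h
    exact h.trans (by linarith [norm_radialProj_le hr x])
  have hFi : Integrable F γ := Integrable.of_bound hF.continuous.measurable.aestronglyMeasurable 4
    (Filter.Eventually.of_forall hFb)
  -- Dividing by `max ‖x‖ r` instead of `‖x‖` can only shrink a nonnegative function of degree two,
  -- so the Gaussian mean of `F` is bounded by the spherical mean of `f`.
  have hFf : ∀ x, F x ≤ f (‖x‖⁻¹ • x) := by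
    intro x
    simp only [F, radialProj, hfs]
    rcases eq_or_ne x 0 with rfl | hx
    · simp [hf00]
    have hx : 0 < ‖x‖ := norm_pos_iff.mpr hx
    have := hf0 x
    gcongr
    exact le_max_left _ _
  have hFe : ∀ x, r ≤ ‖x‖ → F x = f (‖x‖⁻¹ • x) := by
    intro x hx
    simp only [F, radialProj, max_eq_left hx]
  have hmean : ∫ x, F x ∂γ ≤ M := by
    have h1 : ENNReal.ofReal (∫ x, F x ∂γ) ≤ ENNReal.ofReal M := by
      rw [ofReal_integral_eq_lintegral_ofReal hFi (Filter.Eventually.of_forall fun x => hf0 _)]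
      have hw : Measurable (Set.indicator (Set.Ioi (0 : ℝ)) (1 : ℝ → ℝ≥0∞)) :=
        measurable_one.indicator measurableSet_Ioi
      calc ∫⁻ x, ENNReal.ofReal (F x) ∂γ
          ≤ ∫⁻ x, Set.indicator (Set.Ioi (0 : ℝ)) (1 : ℝ → ℝ≥0∞) ‖x‖ *
            ENNReal.ofReal (f (‖x‖⁻¹ • x)) ∂γ := by
            refine lintegral_mono fun x => ?_
            rcases eq_or_ne x 0 with rfl | hx
            · simp [F, radialProj, hf00]
            · simp only [Set.indicator, Set.mem_Ioi, norm_pos_iff.mpr hx, if_true, Pi.one_apply,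
                one_mul]
              exact ENNReal.ofReal_le_ofReal (hFf x)
        _ = _ := lintegral_radial_mul_angular hUm hUp hUn hUs hκ hw (by simp)
            (ENNReal.measurable_ofReal.comp hfc.measurable)
        _ ≤ 1 * ∫⁻ x, ENNReal.ofReal (f x) ∂κ := by
            refine mul_le_mul_left ?_ _
            calc _ ≤ ∫⁻ _x, 1 ∂γ := by
                  refine lintegral_mono fun x => ?_
                  exact Set.indicator_le_self' (fun _ _ => zero_le) _
              _ = 1 := by simp
        _ ≤ _ := by rw [one_mul]; exact hM
    exact (ENNReal.ofReal_le_ofReal_iff hM0).mp h1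
  have hconc := stdGaussian_concentration hF hKpos hFb hs
  have hA : MeasurableSet {x | M + s ≤ f x} := measurableSet_le measurable_const hfc.measurable
  have hw : Measurable (Set.indicator (Set.Ici r) (1 : ℝ → ℝ≥0∞)) :=
    measurable_one.indicator measurableSet_Ici
  have hpol := lintegral_radial_mul_angular hUm hUp hUn hUs hκ hw
    (by simp [hr]) (h := Set.indicator {x | M + s ≤ f x} 1) (measurable_one.indicator hA)
  rw [lintegral_indicator_one hA] at hpol
  have hrad : ∫⁻ x, Set.indicator (Set.Ici r) (1 : ℝ → ℝ≥0∞) ‖x‖ ∂γ = γ {x | r ≤ ‖x‖} := by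
    rw [← lintegral_indicator_one (measurableSet_le measurable_const measurable_norm)]
    rfl
  rw [hrad] at hpol
  -- Outside the ball of radius `r`, `F` is `f` of the direction. Independence makes the left side
  -- the probability of a large norm together with a bad direction, and such points are in the
  -- Gaussian tail because the mean of `F` is at most `M`.
  have hle : γ {x | r ≤ ‖x‖} * κ {x | M + s ≤ f x} ≤ γ {x | (∫ x, F x ∂γ) + s ≤ F x} := by
    rw [← hpol, ← lintegral_indicator_one (measurableSet_le measurable_const hF.continuous.measurable)]
    refine lintegral_mono fun x => ?_
    simp only [Set.indicator, Set.mem_Ici, Set.mem_ofPred_eq, Pi.one_apply]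
    split_ifs with h1 h2 h3 <;> simp only [mul_one, mul_zero, le_refl, zero_le]
    exfalso
    apply h3
    rw [hFe x h1]
    linarith
  have hhalf : ENNReal.ofReal (1 / 2) ≤ γ {x | r ≤ ‖x‖} :=
    (ENNReal.ofReal_le_iff_le_toReal (measure_ne_top _ _)).mpr (half_le_stdGaussian_norm_ge hn)
  have hconc' : γ {x | (∫ x, F x ∂γ) + s ≤ F x} ≤
      ENNReal.ofReal (exp (-(n * s ^ 2 / (64 * π ^ 2)))) := by
    refine (ENNReal.le_ofReal_iff_toReal_le (measure_ne_top _ _) (exp_pos _).le).mpr ?_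
    refine hconc.trans_eq ?_
    congr 2
    change 2 * s ^ 2 / (π ^ 2 * (4 / r) ^ 2) = _
    rw [div_pow, hr2]
    field_simp
    ring
  have h2 : ENNReal.ofReal 2 * ENNReal.ofReal (1 / 2) = 1 := by
    rw [← ENNReal.ofReal_mul (by norm_num)]; norm_num
  calc κ {x | M + s ≤ f x}
      = ENNReal.ofReal 2 * (ENNReal.ofReal (1 / 2) * κ {x | M + s ≤ f x}) := by
        rw [← mul_assoc, h2, one_mul]
    _ ≤ ENNReal.ofReal 2 * ENNReal.ofReal (exp (-(n * s ^ 2 / (64 * π ^ 2)))) := by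
        gcongr
        exact le_trans (by gcongr) (hle.trans hconc')
    _ = _ := (ENNReal.ofReal_mul (by norm_num)).symm

end

/-! ### Duality for the trace norm -/

open scoped Matrix ComplexOrder

section TraceNorm
variable {n : Type*} [Fintype n] [DecidableEq n]

/-- The matrix `B` has operator norm at most one. -/
def IsContraction (B : Matrix n n ℂ) : Prop :=
  ∀ x : EuclideanSpace ℂ n, ‖Matrix.toEuclideanLin B x‖ ≤ ‖x‖

/-- The right singular vectors of a matrix. -/
def rightSingular (A : Matrix n n ℂ) : OrthonormalBasis n ℂ (EuclideanSpace ℂ n) :=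
  (Matrix.isHermitian_conjTranspose_mul_self A).eigenvectorBasis

/-- The singular values of a matrix. -/
def singularVal (A : Matrix n n ℂ) (i : n) : ℝ :=
  √((Matrix.isHermitian_conjTranspose_mul_self A).eigenvalues i)

lemma traceNorm_eq_sum (A : Matrix n n ℂ) : traceNorm A = ∑ i, singularVal A i := rfl

lemma singularVal_nonneg (A : Matrix n n ℂ) (i : n) : 0 ≤ singularVal A i := sqrt_nonneg _

lemma traceNorm_nonneg (A : Matrix n n ℂ) : 0 ≤ traceNorm A :=
  Finset.sum_nonneg fun i _ => singularVal_nonneg A i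

lemma singularVal_sq (A : Matrix n n ℂ) (i : n) :
    singularVal A i ^ 2 = (Matrix.isHermitian_conjTranspose_mul_self A).eigenvalues i :=
  sq_sqrt ((Matrix.posSemidef_conjTranspose_mul_self A).eigenvalues_nonneg i)

/-- The singular value decomposition in the form used below: the images of the right singular
vectors are orthogonal, with the singular values as lengths. -/
lemma inner_apply_rightSingular (A : Matrix n n ℂ) (i j : n) :
    inner ℂ (Matrix.toEuclideanLin A (rightSingular A i)) (Matrix.toEuclideanLin A (rightSingular A j))
      = if i = j then (singularVal A i : ℂ) ^ 2 else 0 := by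
  have h := (Matrix.isHermitian_conjTranspose_mul_self A).mulVec_eigenvectorBasis j
  have h2 : Matrix.toEuclideanLin Aᴴ (Matrix.toEuclideanLin A (rightSingular A j)) =
      (singularVal A j : ℂ) ^ 2 • rightSingular A j := by
    apply (WithLp.ofLp_injective 2)
    simp only [Matrix.ofLp_toLpLin, Matrix.toLin'_apply, Matrix.mulVec_mulVec, WithLp.ofLp_smul]
    rw [rightSingular, h, ← singularVal_sq]
    ext x
    simp
  rw [← LinearMap.adjoint_inner_right, ← Matrix.toEuclideanLin_conjTranspose_eq_adjoint, h2,
    inner_smul_right, orthonormal_iff_ite.mp (rightSingular A).orthonormal i j]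
  split_ifs with hij
  · rw [hij, mul_one]
  · rw [mul_zero]

lemma norm_apply_rightSingular (A : Matrix n n ℂ) (i : n) :
    ‖Matrix.toEuclideanLin A (rightSingular A i)‖ = singularVal A i := by
  have h := inner_apply_rightSingular A i i
  rw [if_pos rfl, inner_self_eq_norm_sq_to_K] at h
  have h' : ‖Matrix.toEuclideanLin A (rightSingular A i)‖ ^ 2 = singularVal A i ^ 2 := by
    apply Complex.ofReal_injective
    push_cast
    exact h
  exact (pow_left_inj₀ (norm_nonneg _) (singularVal_nonneg A i) two_ne_zero).mp h'

lemma trace_eq_sum_inner (b : OrthonormalBasis n ℂ (EuclideanSpace ℂ n)) (A : Matrix n n ℂ) :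
    A.trace = ∑ i, inner ℂ (b i) (Matrix.toEuclideanLin A (b i)) := by
  rw [← LinearMap.trace_eq_sum_inner _ b, Matrix.toEuclideanLin, Matrix.toLpLin_eq_toLin,
    Matrix.trace_toLin_eq]

lemma norm_trace_mul_le_traceNorm {B : Matrix n n ℂ} (hB : IsContraction B) (A : Matrix n n ℂ) :
    ‖(B * A).trace‖ ≤ traceNorm A := by
  rw [trace_eq_sum_inner (rightSingular A), traceNorm_eq_sum]
  refine (norm_sum_le _ _).trans (Finset.sum_le_sum fun i _ => ?_)
  refine (norm_inner_le_norm _ _).trans ?_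
  rw [(rightSingular A).orthonormal.1 i, one_mul, ← norm_apply_rightSingular]
  have : Matrix.toEuclideanLin (B * A) (rightSingular A i) =
      Matrix.toEuclideanLin B (Matrix.toEuclideanLin A (rightSingular A i)) := by
    apply (WithLp.ofLp_injective 2)
    simp
  rw [this]
  exact hB _

lemma norm_trace_le_card {B : Matrix n n ℂ} (hB : IsContraction B) :
    ‖B.trace‖ ≤ Fintype.card n := by
  rw [trace_eq_sum_inner (EuclideanSpace.basisFun n ℂ)]
  refine (norm_sum_le _ _).trans ?_
  calc _ ≤ ∑ _i : n, (1 : ℝ) := by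
        refine Finset.sum_le_sum fun i _ => ?_
        refine (norm_inner_le_norm _ _).trans ?_
        have h1 := (EuclideanSpace.basisFun n ℂ).orthonormal.1 i
        rw [h1, one_mul]
        exact (hB _).trans h1.le
    _ = _ := by simp

/-- The optimal contraction sends the normalised image `A v i / σ i` back to `v i`; Bessel's
inequality shows that it is a contraction. Zero singular values drop out because `0⁻¹ = 0`. -/
lemma exists_contraction_trace_eq (A : Matrix n n ℂ) :
    ∃ B : Matrix n n ℂ, IsContraction B ∧ (B * A).trace = traceNorm A := by
  set v := rightSingular A
  let a := Matrix.toEuclideanLin A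
  let T : EuclideanSpace ℂ n →ₗ[ℂ] EuclideanSpace ℂ n :=
    ∑ i, ((innerₛₗ ℂ (((singularVal A i)⁻¹ : ℂ) • a (v i))).smulRight (v i))
  have hT : ∀ x, T x = ∑ i, inner ℂ (((singularVal A i)⁻¹ : ℂ) • a (v i)) x • v i := by
    intro x
    simp only [T, LinearMap.sum_apply, LinearMap.smulRight_apply, innerₛₗ_apply_apply]
  have hBT : Matrix.toEuclideanLin (Matrix.toEuclideanLin.symm T) = T :=
    Matrix.toEuclideanLin.apply_symm_apply T
  refine ⟨Matrix.toEuclideanLin.symm T, fun x => ?_, ?_⟩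
  · rw [hBT, hT]
    let J := {i : n // singularVal A i ≠ 0}
    let e : J → EuclideanSpace ℂ n := fun i => ((singularVal A i)⁻¹ : ℂ) • a (v i)
    have he : Orthonormal ℂ e := by
      rw [orthonormal_iff_ite]
      intro i j
      have hi := i.2
      simp only [e, inner_smul_left, inner_smul_right, a, v, inner_apply_rightSingular]
      by_cases h : i = j
      · subst h
        have : (singularVal A i : ℂ) ≠ 0 := by exact_mod_cast hi
        simp only [if_true, map_inv₀, Complex.conj_ofReal]
        field_simp
      · rw [if_neg h, if_neg fun h' => h (Subtype.ext h'), mul_zero, mul_zero]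
    have hb := he.sum_inner_products_le x (s := Finset.univ)
    have hsum : ∑ i, ‖inner ℂ (((singularVal A i)⁻¹ : ℂ) • a (v i)) x‖ ^ 2 =
        ∑ i : J, ‖inner ℂ (e i) x‖ ^ 2 := by
      rw [← Finset.sum_filter_add_sum_filter_not Finset.univ (fun i => singularVal A i ≠ 0)]
      rw [Finset.sum_eq_zero (s := Finset.univ.filter fun i => ¬ singularVal A i ≠ 0), add_zero]
      · exact Finset.sum_subtype _ (by simp) _
      · intro i hi
        have : singularVal A i = 0 := by simpa using hi
        simp [this]
    have hn : ‖∑ i, inner ℂ (((singularVal A i)⁻¹ : ℂ) • a (v i)) x • v i‖ ^ 2 =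
        ∑ i, ‖inner ℂ (((singularVal A i)⁻¹ : ℂ) • a (v i)) x‖ ^ 2 := by
      rw [@norm_sq_eq_re_inner ℂ, v.orthonormal.inner_sum, map_sum]
      refine Finset.sum_congr rfl fun i _ => ?_
      rw [RCLike.conj_mul]
      norm_cast
    rw [← hsum, ← hn] at hb
    exact (pow_le_pow_iff_left₀ (norm_nonneg _) (norm_nonneg _) two_ne_zero).mp hb
  · rw [trace_eq_sum_inner v, traceNorm_eq_sum, Complex.ofReal_sum]
    refine Finset.sum_congr rfl fun i _ => ?_
    have h1 : Matrix.toEuclideanLin (Matrix.toEuclideanLin.symm T * A) (v i) = T (a (v i)) := by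
      rw [← hBT]
      apply (WithLp.ofLp_injective 2)
      simp [a]
    rw [h1, hT, v.orthonormal.inner_right_fintype]
    simp only [inner_smul_left, a, v, inner_apply_rightSingular, if_true, map_inv₀,
      Complex.conj_ofReal]
    by_cases h : (singularVal A i : ℂ) = 0
    · simp [h]
    · field_simp

lemma traceNorm_smul {r : ℝ} (hr : 0 ≤ r) (A : Matrix n n ℂ) :
    traceNorm ((r : ℂ) • A) = r * traceNorm A := by
  apply le_antisymm
  · obtain ⟨B, hB, h⟩ := exists_contraction_trace_eq ((r : ℂ) • A)
    rw [← Real.norm_of_nonneg (traceNorm_nonneg _), ← Complex.norm_real, ← h, Matrix.mul_smul,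
      Matrix.trace_smul, norm_smul, Complex.norm_real, Real.norm_of_nonneg hr]
    exact mul_le_mul_of_nonneg_left (norm_trace_mul_le_traceNorm hB A) hr
  · obtain ⟨B, hB, h⟩ := exists_contraction_trace_eq A
    have := norm_trace_mul_le_traceNorm hB ((r : ℂ) • A)
    rwa [Matrix.mul_smul, Matrix.trace_smul, norm_smul, Complex.norm_real, Real.norm_of_nonneg hr,
      h, Complex.norm_real, Real.norm_of_nonneg (traceNorm_nonneg _)] at this

/-- The contraction optimal for `A` is a competitor for `A'`. -/
lemma traceNorm_sub_le_of_forall {A A' : Matrix n n ℂ} {c : ℝ}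
    (h : ∀ B, IsContraction B → ‖(B * A).trace - (B * A').trace‖ ≤ c) :
    traceNorm A - traceNorm A' ≤ c := by
  obtain ⟨B, hB, hA⟩ := exists_contraction_trace_eq A
  have h1 := h B hB
  have h2 := norm_trace_mul_le_traceNorm hB A'
  have h3 : traceNorm A = ‖(B * A).trace‖ := by
    rw [hA, Complex.norm_real, Real.norm_of_nonneg (traceNorm_nonneg _)]
  have := norm_sub_norm_le (B * A).trace (B * A').trace
  linarith

/-- Cauchy–Schwarz on the singular values, whose squares sum to `tr (Aᴴ A)`. -/
lemma traceNorm_sq_le (A : Matrix n n ℂ) :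
    traceNorm A ^ 2 ≤ Fintype.card n * ∑ i, ∑ j, ‖A i j‖ ^ 2 := by
  have h1 : ∑ i, singularVal A i ^ 2 = ∑ i, ∑ j, ‖A i j‖ ^ 2 := by
    have h := (Matrix.isHermitian_conjTranspose_mul_self A).trace_eq_sum_eigenvalues
    have h' : (Aᴴ * A).trace = ((∑ i, ∑ j, ‖A i j‖ ^ 2 : ℝ) : ℂ) := by
      simp only [Matrix.trace, Matrix.diag, Matrix.mul_apply, Matrix.conjTranspose_apply]
      rw [Finset.sum_comm]
      push_cast
      refine Finset.sum_congr rfl fun i _ => Finset.sum_congr rfl fun j _ => ?_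
      rw [← Complex.conj_mul']
      rfl
    rw [h'] at h
    simp_rw [singularVal_sq]
    apply Complex.ofReal_injective
    rw [h, Complex.ofReal_sum]
    rfl
  rw [← h1, traceNorm_eq_sum]
  have := sq_sum_le_card_mul_sum_sq (s := Finset.univ) (f := singularVal A)
  simpa using this

end TraceNorm

/-! ### The deviation of a reduced state from the maximally mixed state -/

section Deviation
variable {m d : ℕ} (S : Finset (Fin m))

/-- The slice of a vector along a word on the complement of `S`. -/
def slice (y : H m d) (c : {i // i ∉ S} → Fin d) : EuclideanSpace ℂ ({i // i ∈ S} → Fin d) :=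
  WithLp.toLp 2 fun a => y (glue S a c)

/-- Words are pairs of words on `S` and on its complement. -/
def glueEquiv (d : ℕ) :
    (({i // i ∈ S} → Fin d) × ({i // i ∉ S} → Fin d)) ≃ (Fin m → Fin d) where
  toFun p := glue S p.1 p.2
  invFun x := (fun i => x i, fun i => x i)
  left_inv p := by
    refine Prod.ext (funext fun i => ?_) (funext fun i => ?_)
    · simp [glue, i.2]
    · simp [glue, i.2]
  right_inv x := by
    funext i
    simp [glue]

lemma glueEquiv_apply (p : ({i // i ∈ S} → Fin d) × ({i // i ∉ S} → Fin d)) :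
    glueEquiv S d p = glue S p.1 p.2 := rfl

lemma sum_glue {M : Type*} [AddCommMonoid M] (g : (Fin m → Fin d) → M) :
    ∑ a, ∑ c, g (glue S a c) = ∑ x, g x := by
  rw [← (glueEquiv S d).sum_comp, Fintype.sum_prod_type]
  rfl

lemma sum_norm_slice_sq (y : H m d) : ∑ c, ‖slice S y c‖ ^ 2 = ‖y‖ ^ 2 := by
  simp_rw [EuclideanSpace.norm_sq_eq]
  rw [Finset.sum_comm]
  exact sum_glue S fun x => ‖y x‖ ^ 2

/-- The sesquilinear form `⟨z, (B ⊗ 1) y⟩`. -/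
def localForm (B : Matrix ({i // i ∈ S} → Fin d) ({i // i ∈ S} → Fin d) ℂ) (z y : H m d) : ℂ :=
  ∑ c, inner ℂ (slice S z c) (Matrix.toEuclideanLin B (slice S y c))

lemma norm_localForm_le {B : Matrix ({i // i ∈ S} → Fin d) ({i // i ∈ S} → Fin d) ℂ}
    (hB : IsContraction B) (z y : H m d) : ‖localForm S B z y‖ ≤ ‖z‖ * ‖y‖ := by
  calc _ ≤ ∑ c, ‖slice S z c‖ * ‖slice S y c‖ := by
        refine (norm_sum_le _ _).trans (Finset.sum_le_sum fun c _ => ?_)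
        exact (norm_inner_le_norm _ _).trans (mul_le_mul_of_nonneg_left (hB _) (norm_nonneg _))
    _ ≤ √(∑ c, ‖slice S z c‖ ^ 2) * √(∑ c, ‖slice S y c‖ ^ 2) :=
        Real.sum_mul_le_sqrt_mul_sqrt _ _ _
    _ = _ := by
        rw [sum_norm_slice_sq, sum_norm_slice_sq, sqrt_sq (norm_nonneg _), sqrt_sq (norm_nonneg _)]

/-- Defining property of the partial trace: an observable on `S` sees only the reduced state.
Duality thus turns trace norm estimates into estimates of a bounded sesquilinear form. -/
lemma trace_mul_reduced (B : Matrix ({i // i ∈ S} → Fin d) ({i // i ∈ S} → Fin d) ℂ)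
    (y : H m d) : (B * reduced S y).trace = localForm S B y y := by
  simp only [Matrix.trace, Matrix.diag, Matrix.mul_apply, reduced, partialTrace, ketbra,
    Matrix.of_apply, localForm, PiLp.inner_apply, Matrix.ofLp_toLpLin, Matrix.toLin'_apply, Matrix.mulVec,
    dotProduct, slice, Finset.mul_sum]
  simp_rw [RCLike.inner_apply, Finset.sum_mul]
  rw [Finset.sum_comm' (t' := Finset.univ) (s' := fun _ => Finset.univ) (by simp)]
  simp_rw [Finset.sum_comm (s := Finset.univ (α := {i // i ∉ S} → Fin d))]
  rw [Finset.sum_comm]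
  refine Finset.sum_congr rfl fun a _ => Finset.sum_congr rfl fun b _ =>
    Finset.sum_congr rfl fun c _ => ?_
  simp only [starRingEnd_apply]
  ring

lemma localForm_self_sub (B : Matrix ({i // i ∈ S} → Fin d) ({i // i ∈ S} → Fin d) ℂ)
    (y z : H m d) : localForm S B y y - localForm S B z z =
      localForm S B y (y - z) + localForm S B (y - z) z := by
  have hs : ∀ c, slice S (y - z) c = slice S y c - slice S z c := fun c => rfl
  simp only [localForm, hs, map_sub, inner_sub_left, inner_sub_right, Finset.sum_sub_distrib]
  ring

/-- The trace norm of `tr_{Sᶜ} |y⟩⟨y| - ‖y‖² 1 / d ^ |S|`. -/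
def deviation (y : H m d) : ℝ :=
  traceNorm (reduced S y - ((‖y‖ ^ 2 : ℝ) : ℂ) • maxMixed m d S)

lemma deviation_eq_traceDist {y : H m d} (hy : ‖y‖ = 1) :
    deviation S y = traceDist (reduced S y) (maxMixed m d S) := by
  simp [deviation, traceDist, hy]

lemma deviation_nonneg (y : H m d) : 0 ≤ deviation S y := traceNorm_nonneg _

lemma reduced_smul (c : ℝ) (y : H m d) :
    reduced S ((c : ℂ) • y) = ((c ^ 2 : ℝ) : ℂ) • reduced S y := by
  ext a b
  simp only [reduced, partialTrace, ketbra, Matrix.of_apply, Matrix.smul_apply, Finset.smul_sum]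
  refine Finset.sum_congr rfl fun x _ => ?_
  simp only [PiLp.smul_apply, smul_eq_mul, star_mul', Complex.star_def, Complex.conj_ofReal]
  push_cast
  ring

lemma deviation_smul (c : ℝ) (y : H m d) : deviation S ((c : ℂ) • y) = c ^ 2 * deviation S y := by
  rw [deviation, deviation, ← traceNorm_smul (sq_nonneg c), reduced_smul, norm_smul, mul_pow,
    Complex.norm_real, Real.norm_eq_abs, sq_abs, smul_sub, smul_smul]
  push_cast
  rfl

lemma norm_trace_mul_maxMixed_le (hd : 0 < d)
    {B : Matrix ({i // i ∈ S} → Fin d) ({i // i ∈ S} → Fin d) ℂ} (hB : IsContraction B) :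
    ‖(B * maxMixed m d S).trace‖ ≤ 1 := by
  have h := norm_trace_le_card hB
  simp only [Fintype.card_pi, Finset.prod_const, Fintype.card_fin, Finset.card_univ,
    Fintype.card_coe] at h
  rw [maxMixed, Matrix.mul_smul, mul_one, Matrix.trace_smul, norm_smul, norm_inv, norm_pow,
    Complex.norm_natCast, inv_mul_le_one₀ (by positivity)]
  exact_mod_cast h

lemma trace_mul_deviation_matrix (B : Matrix ({i // i ∈ S} → Fin d) ({i // i ∈ S} → Fin d) ℂ)
    (y : H m d) : (B * (reduced S y - ((‖y‖ ^ 2 : ℝ) : ℂ) • maxMixed m d S)).trace =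
      localForm S B y y - ((‖y‖ ^ 2 : ℝ) : ℂ) * (B * maxMixed m d S).trace := by
  rw [Matrix.mul_sub, Matrix.trace_sub, trace_mul_reduced, Matrix.mul_smul, Matrix.trace_smul,
    smul_eq_mul]

/-- The difference of squared norms is kept apart because it vanishes on the sphere: there the
Lipschitz constant is 2, against 4 on the ball. -/
lemma deviation_sub_le (hd : 0 < d) (y z : H m d) :
    deviation S y - deviation S z ≤ (‖y‖ + ‖z‖) * ‖y - z‖ + |‖y‖ ^ 2 - ‖z‖ ^ 2| := by
  refine traceNorm_sub_le_of_forall fun B hB => ?_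
  rw [trace_mul_deviation_matrix, trace_mul_deviation_matrix]
  have h1 : localForm S B y y - ((‖y‖ ^ 2 : ℝ) : ℂ) * (B * maxMixed m d S).trace -
      (localForm S B z z - ((‖z‖ ^ 2 : ℝ) : ℂ) * (B * maxMixed m d S).trace) =
      (localForm S B y (y - z) + localForm S B (y - z) z) -
        ((‖y‖ ^ 2 - ‖z‖ ^ 2 : ℝ) : ℂ) * (B * maxMixed m d S).trace := by
    rw [← localForm_self_sub]
    push_cast
    ring
  rw [h1]
  refine (norm_sub_le _ _).trans (add_le_add ((norm_add_le _ _).trans ?_) ?_)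
  · have h2 := norm_localForm_le S hB y (y - z)
    have h3 := norm_localForm_le S hB (y - z) z
    linarith
  · rw [norm_mul, Complex.norm_real, Real.norm_eq_abs]
    exact mul_le_of_le_one_right (abs_nonneg _) (norm_trace_mul_maxMixed_le S hd hB)

lemma abs_deviation_sub_le (hd : 0 < d) (y z : H m d) :
    |deviation S y - deviation S z| ≤ (‖y‖ + ‖z‖) * ‖y - z‖ + |‖y‖ ^ 2 - ‖z‖ ^ 2| := by
  rw [abs_le']
  refine ⟨deviation_sub_le S hd y z, ?_⟩
  have := deviation_sub_le S hd z y
  rw [norm_sub_rev, abs_sub_comm] at this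
  linarith

lemma deviation_le (hd : 0 < d) (y : H m d) : deviation S y ≤ 2 * ‖y‖ ^ 2 := by
  have h := deviation_sub_le S hd y 0
  have h0 : deviation S (0 : H m d) = 0 := by
    have := deviation_smul S 0 (0 : H m d)
    simpa using this
  rw [h0] at h
  simp only [sub_zero, norm_zero, add_zero, ne_eq, OfNat.ofNat_ne_zero, not_false_eq_true,
    zero_pow, abs_of_nonneg (sq_nonneg ‖y‖)] at h
  linarith

lemma abs_deviation_sub_le_four (hd : 0 < d) {y z : H m d} (hy : ‖y‖ ≤ 1) (hz : ‖z‖ ≤ 1) :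
    |deviation S y - deviation S z| ≤ 4 * ‖y - z‖ := by
  refine (abs_deviation_sub_le S hd y z).trans ?_
  have h1 : |‖y‖ ^ 2 - ‖z‖ ^ 2| ≤ 2 * ‖y - z‖ := by
    rw [sq_sub_sq, abs_mul]
    refine mul_le_mul ?_ (abs_norm_sub_norm_le y z) (abs_nonneg _) (by norm_num)
    rw [abs_of_nonneg (by positivity)]
    linarith
  have h2 : (‖y‖ + ‖z‖) * ‖y - z‖ ≤ 2 * ‖y - z‖ :=
    mul_le_mul_of_nonneg_right (by linarith) (norm_nonneg _)
  linarith

lemma continuous_deviation (hd : 0 < d) : Continuous (deviation S : H m d → ℝ) := by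
  rw [continuous_iff_continuousAt]
  intro z
  rw [ContinuousAt, tendsto_iff_dist_tendsto_zero]
  have hb : Continuous fun y : H m d => (‖y‖ + ‖z‖) * ‖y - z‖ + |‖y‖ ^ 2 - ‖z‖ ^ 2| := by fun_prop
  have h0 := hb.tendsto z
  simp only [sub_self, norm_zero, mul_zero, abs_zero, add_zero] at h0
  exact squeeze_zero (fun _ => dist_nonneg) (fun y => abs_deviation_sub_le S hd y z) h0

end Deviation

/-! ### Second moment of the deviation under a unitarily invariant law -/

lemma exists_linearIsometryEquiv_apply_eq {E : Type*} [NormedAddCommGroup E]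
    [InnerProductSpace ℂ E] [FiniteDimensional ℂ E] {u v : E} (hu : ‖u‖ = 1) (hv : ‖v‖ = 1) :
    ∃ V : E ≃ₗᵢ[ℂ] E, V u = v := by
  let f := LinearIsometryEquiv.toSpanUnitSingleton (𝕜 := ℂ) u hu
  let g : ℂ →ₗᵢ[ℂ] E := LinearIsometry.toSpanSingleton ℂ E hv
  let L : (ℂ ∙ u) →ₗᵢ[ℂ] E := g.comp f.symm.toLinearIsometry
  refine ⟨L.extend.toLinearIsometryEquiv rfl, ?_⟩
  have h1 : f 1 = ⟨u, Submodule.mem_span_singleton_self u⟩ := by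
    ext; simp [f, LinearIsometryEquiv.toSpanUnitSingleton_apply]
  have h2 := L.extend_apply ⟨u, Submodule.mem_span_singleton_self u⟩
  rw [LinearIsometry.coe_toLinearIsometryEquiv, h2, ← h1]
  simp [L, g]

section Moments
variable {ι : Type*} [Fintype ι]

/-- A unitarily invariant law on the unit sphere. -/
structure IsSphereLaw (κ : Measure (EuclideanSpace ℂ ι)) : Prop where
  prob : IsProbabilityMeasure κ
  norm_eq_one : ∀ᵐ ψ ∂κ, ‖ψ‖ = 1
  map_eq : ∀ V : EuclideanSpace ℂ ι ≃ₗᵢ[ℂ] EuclideanSpace ℂ ι, κ.map V = κ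

variable {κ : Measure (EuclideanSpace ℂ ι)}

lemma IsSphereLaw.integral_comp (hκ : IsSphereLaw κ) {F : Type*} [NormedAddCommGroup F]
    [NormedSpace ℝ F] (V : EuclideanSpace ℂ ι ≃ₗᵢ[ℂ] EuclideanSpace ℂ ι)
    (g : EuclideanSpace ℂ ι → F) : ∫ ψ, g (V ψ) ∂κ = ∫ ψ, g ψ ∂κ := by
  conv_rhs => rw [← hκ.map_eq V]
  exact (V.toHomeomorph.measurableEmbedding.integral_map g).symm

lemma IsSphereLaw.integrable (hκ : IsSphereLaw κ) {F : Type*} [NormedAddCommGroup F]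
    {g : EuclideanSpace ℂ ι → F} [SecondCountableTopology F] (hg : Continuous g) : Integrable g κ := by
  have := hκ.prob
  obtain ⟨C, hC⟩ := (isCompact_sphere (0 : EuclideanSpace ℂ ι) 1).exists_bound_of_continuousOn
    hg.continuousOn
  refine Integrable.of_bound hg.aestronglyMeasurable C ?_
  filter_upwards [hκ.norm_eq_one] with ψ hψ
  exact hC ψ (by simpa using hψ)

lemma IsSphereLaw.integral_sum (hκ : IsSphereLaw κ) {F σ : Type*} [NormedAddCommGroup F]
    [NormedSpace ℝ F] [SecondCountableTopology F] [Fintype σ] {g : σ → EuclideanSpace ℂ ι → F}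
    (hg : ∀ i, Continuous (g i)) : ∫ ψ, (∑ i, g i ψ) ∂κ = ∑ i, ∫ ψ, g i ψ ∂κ :=
  integral_finsetSum _ fun i _ => hκ.integrable (hg i)

/-- The fourth moment of a component does not depend on its direction. -/
lemma IsSphereLaw.fourth_moment_eq (hκ : IsSphereLaw κ) {u v : EuclideanSpace ℂ ι}
    (hu : ‖u‖ = 1) (hv : ‖v‖ = 1) :
    ∫ ψ, ‖inner ℂ u ψ‖ ^ 4 ∂κ = ∫ ψ, ‖inner ℂ v ψ‖ ^ 4 ∂κ := by
  obtain ⟨V, hV⟩ := exists_linearIsometryEquiv_apply_eq hu hv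
  rw [← hκ.integral_comp V fun ψ => ‖inner ℂ v ψ‖ ^ 4, ← hV]
  simp

variable [DecidableEq ι]

lemma IsSphereLaw.fourth_moment_smul (hκ : IsSphereLaw κ) (u : EuclideanSpace ℂ ι) (i : ι) :
    ∫ ψ, ‖inner ℂ u ψ‖ ^ 4 ∂κ = ‖u‖ ^ 4 * ∫ ψ, ‖ψ i‖ ^ 4 ∂κ := by
  rcases eq_or_ne u 0 with rfl | hu
  · simp
  have h1 : ‖((‖u‖ : ℂ)⁻¹) • u‖ = 1 := norm_smul_inv_norm hu
  have h2 : ‖EuclideanSpace.single i (1 : ℂ)‖ = 1 := by simp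
  have h := hκ.fourth_moment_eq h1 h2
  simp only [EuclideanSpace.inner_single_left, map_one, one_mul] at h
  rw [← h, ← integral_const_mul]
  refine integral_congr_ae (Filter.Eventually.of_forall fun ψ => ?_)
  have : ‖u‖ ≠ 0 := norm_ne_zero_iff.mpr hu
  simp only [inner_smul_left, norm_mul, map_inv₀, Complex.conj_ofReal, norm_inv, Complex.norm_real,
    norm_norm]
  field_simp

/-- Polarization over the fourth roots of unity, which expresses a product of two squared moduli
through fourth powers of linear forms. -/
lemma norm_add_pow_four_sum (z w : ℂ) :
    ‖z + w‖ ^ 4 + ‖z - w‖ ^ 4 + ‖z + Complex.I * w‖ ^ 4 + ‖z - Complex.I * w‖ ^ 4 =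
      4 * ‖z‖ ^ 4 + 4 * ‖w‖ ^ 4 + 16 * (‖z‖ ^ 2 * ‖w‖ ^ 2) := by
  have h : ∀ z : ℂ, ‖z‖ ^ 4 = (z.re ^ 2 + z.im ^ 2) ^ 2 := by
    intro z
    rw [show ‖z‖ ^ 4 = (‖z‖ ^ 2) ^ 2 by ring, Complex.sq_norm, Complex.normSq_apply]
    ring
  have h2 : ∀ z : ℂ, ‖z‖ ^ 2 = z.re ^ 2 + z.im ^ 2 := by
    intro z
    rw [Complex.sq_norm, Complex.normSq_apply]
    ring
  simp only [h, h2, Complex.add_re, Complex.add_im, Complex.sub_re, Complex.sub_im, Complex.mul_re,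
    Complex.mul_im, Complex.I_re, Complex.I_im]
  ring

lemma IsSphereLaw.integral_norm_sq_mul_norm_sq_of_ne (hκ : IsSphereLaw κ) {i j : ι} (hij : i ≠ j)
    (l : ι) : ∫ ψ, ‖ψ i‖ ^ 2 * ‖ψ j‖ ^ 2 ∂κ = (∫ ψ, ‖ψ l‖ ^ 4 ∂κ) / 2 := by
  set A := ∫ ψ, ‖ψ l‖ ^ 4 ∂κ
  have hcoord : ∀ i, ∫ ψ, ‖ψ i‖ ^ 4 ∂κ = A := by
    intro i
    have := hκ.fourth_moment_smul (EuclideanSpace.single i 1) l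
    simpa only [EuclideanSpace.inner_single_left, map_one, one_mul, PiLp.norm_single,
      norm_one, one_pow] using this
  have hpol : ∀ ζ : ℂ, ‖ζ‖ = 1 → ∫ ψ, ‖ψ i + ζ * ψ j‖ ^ 4 ∂κ = 4 * A := by
    intro ζ hζ
    have h := hκ.fourth_moment_smul
      (EuclideanSpace.single i 1 + (starRingEnd ℂ ζ) • EuclideanSpace.single j 1) l
    have hn : ‖EuclideanSpace.single i (1 : ℂ) + (starRingEnd ℂ ζ) • EuclideanSpace.single j 1‖ ^ 2
        = 2 := by
      rw [@norm_add_sq ℂ, norm_smul]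
      simp [inner_smul_right, hij, hζ, EuclideanSpace.inner_single_left]
      norm_num
    rw [show ∀ x : ℝ, x ^ 4 = (x ^ 2) ^ 2 from fun x => by ring, hn] at h
    simp only [inner_add_left, inner_smul_left, EuclideanSpace.inner_single_left, map_one, one_mul,
      Complex.conj_conj] at h
    rw [h]
    change 2 ^ 2 * A = 4 * A
    norm_num
  have h1 := hpol 1 (by simp)
  have h2 := hpol (-1) (by simp)
  have h3 := hpol Complex.I (by simp)
  have h4 := hpol (-Complex.I) (by simp)
  simp only [one_mul, neg_mul, ← sub_eq_add_neg] at h1 h2 h3 h4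
  have hi : ∀ g : EuclideanSpace ℂ ι → ℝ, Continuous g → Integrable g κ := fun g hg =>
    hκ.integrable hg
  -- Each of the four linear forms has squared norm 2, hence fourth moment `4 A`; comparison with
  -- the polarization identity gives `16 A = 8 A + 16 x` for the mixed moment `x`.
  have hsum : ∫ ψ, (‖ψ i + ψ j‖ ^ 4 + ‖ψ i - ψ j‖ ^ 4 + ‖ψ i + Complex.I * ψ j‖ ^ 4 +
      ‖ψ i - Complex.I * ψ j‖ ^ 4) ∂κ = 16 * A := by
    rw [integral_add (hi _ (by fun_prop)) (hi _ (by fun_prop)),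
      integral_add (hi _ (by fun_prop)) (hi _ (by fun_prop)),
      integral_add (hi _ (by fun_prop)) (hi _ (by fun_prop)), h1, h2, h3, h4]
    ring
  simp_rw [norm_add_pow_four_sum] at hsum
  rw [integral_add (hi _ (by fun_prop)) (hi _ (by fun_prop)),
    integral_add (hi _ (by fun_prop)) (hi _ (by fun_prop)), integral_const_mul, integral_const_mul,
    integral_const_mul, hcoord, hcoord] at hsum
  linarith

lemma IsSphereLaw.fourth_moment (hκ : IsSphereLaw κ) (l : ι) :
    ∫ ψ, ‖ψ l‖ ^ 4 ∂κ = 2 / (Fintype.card ι * (Fintype.card ι + 1)) := by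
  have := hκ.prob
  set A := ∫ ψ, ‖ψ l‖ ^ 4 ∂κ with hA
  have hD : (0 : ℝ) < Fintype.card ι := by exact_mod_cast Fintype.card_pos_iff.mpr ⟨l⟩
  have hterm : ∀ i j, ∫ ψ, ‖ψ i‖ ^ 2 * ‖ψ j‖ ^ 2 ∂κ = A / 2 + if i = j then A / 2 else 0 := by
    intro i j
    split_ifs with h
    · subst h
      have := hκ.fourth_moment_smul (EuclideanSpace.single i 1) l
      simp only [EuclideanSpace.inner_single_left, map_one, one_mul, PiLp.norm_single,
        norm_one, one_pow] at this
      rw [add_halves, hA, ← this]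
      refine integral_congr_ae (Filter.Eventually.of_forall fun ψ => ?_)
      ring
    · rw [hκ.integral_norm_sq_mul_norm_sq_of_ne h l, add_zero]
  -- The normalization `‖ψ‖⁴ = 1` fixes the one remaining unknown `A`.
  have hone : ∫ ψ, (∑ i, ∑ j, ‖ψ i‖ ^ 2 * ‖ψ j‖ ^ 2) ∂κ = 1 := by
    have : ∀ᵐ ψ ∂κ, (∑ i, ∑ j, ‖ψ i‖ ^ 2 * ‖ψ j‖ ^ 2) = 1 := by
      filter_upwards [hκ.norm_eq_one] with ψ hψ
      rw [← Finset.sum_mul_sum, ← EuclideanSpace.norm_sq_eq, hψ]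
      norm_num
    rw [integral_congr_ae this]
    simp
  have hsum : ∫ ψ, (∑ i, ∑ j, ‖ψ i‖ ^ 2 * ‖ψ j‖ ^ 2) ∂κ =
      ∑ i, ∑ j, ∫ ψ, ‖ψ i‖ ^ 2 * ‖ψ j‖ ^ 2 ∂κ := by
    rw [hκ.integral_sum fun i => by fun_prop]
    exact Finset.sum_congr rfl fun i _ => hκ.integral_sum fun j => by fun_prop
  simp_rw [hsum, hterm] at hone
  simp only [Finset.sum_add_distrib, Finset.sum_const, Finset.card_univ, nsmul_eq_mul,
    Finset.sum_ite_eq, Finset.mem_univ, if_true] at hone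
  field_simp
  linarith

/-- The second moments of the squared moduli of the coordinates. -/
lemma IsSphereLaw.integral_norm_sq_mul_norm_sq (hκ : IsSphereLaw κ) (i j : ι) :
    ∫ ψ, ‖ψ i‖ ^ 2 * ‖ψ j‖ ^ 2 ∂κ =
      (if i = j then 2 else 1) / (Fintype.card ι * (Fintype.card ι + 1)) := by
  split_ifs with h
  · subst h
    rw [← hκ.fourth_moment i]
    refine integral_congr_ae (Filter.Eventually.of_forall fun ψ => ?_)
    ring
  · rw [hκ.integral_norm_sq_mul_norm_sq_of_ne h i, hκ.fourth_moment]
    ring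

/-- Mixed moments in which a coordinate occurs only once vanish. -/
lemma IsSphereLaw.integral_eq_zero (hκ : IsSphereLaw κ) {x y z w : ι} (hy : x ≠ y) (hz : x ≠ z)
    (hw : x ≠ w) : ∫ ψ, ψ x * star (ψ y) * (star (ψ z) * ψ w) ∂κ = 0 := by
  let V : EuclideanSpace ℂ ι ≃ₗᵢ[ℂ] EuclideanSpace ℂ ι :=
    LinearIsometryEquiv.piLpCongrRight 2 fun i =>
      if i = x then LinearIsometryEquiv.neg ℂ else LinearIsometryEquiv.refl ℂ ℂ
  have hVx : ∀ ψ, V ψ x = - ψ x := by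
    intro ψ; simp [V]
  have hV : ∀ ψ i, x ≠ i → V ψ i = ψ i := by
    intro ψ i hi; simp [V, hi.symm]
  have h := hκ.integral_comp V fun ψ => ψ x * star (ψ y) * (star (ψ z) * ψ w)
  simp only [hVx, hV _ _ hy, hV _ _ hz, hV _ _ hw, neg_mul] at h
  rw [integral_neg] at h
  linear_combination (-(1 : ℂ) / 2) * h

end Moments

section SecondMoment
variable {m d : ℕ} (S : Finset (Fin m))

lemma card_words : Fintype.card ({i // i ∈ S} → Fin d) = d ^ S.card := by simp

lemma card_words_mul : (Fintype.card ({i // i ∈ S} → Fin d)) * Fintype.card ({i // i ∉ S} → Fin d) =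
    d ^ m := by
  rw [← Fintype.card_prod, Fintype.card_congr (glueEquiv S d)]
  simp

lemma glue_inj {a b : {i // i ∈ S} → Fin d} {c c' : {i // i ∉ S} → Fin d} :
    glue S a c = glue S b c' ↔ a = b ∧ c = c' := by
  rw [← glueEquiv_apply S (a, c), ← glueEquiv_apply S (b, c'), (glueEquiv S d).injective.eq_iff,
    Prod.mk.injEq]

variable {κ : Measure (H m d)}

/-- If `a = b` or `c = c'` the integrand is a product of squared moduli. Otherwise the four words
are distinct and the sign flip of one coordinate kills the integral. -/
lemma IsSphereLaw.integral_glue (hκ : IsSphereLaw κ) (a b : {i // i ∈ S} → Fin d)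
    (c c' : {i // i ∉ S} → Fin d) :
    ∫ ψ, ψ (glue S a c) * star (ψ (glue S b c)) * (star (ψ (glue S a c')) * ψ (glue S b c')) ∂κ =
      ((((if a = b then 1 else 0) + (if c = c' then 1 else 0)) /
        ((d : ℝ) ^ m * ((d : ℝ) ^ m + 1)) : ℝ) : ℂ) := by
  have hcard : (Fintype.card (Fin m → Fin d) : ℝ) = (d : ℝ) ^ m := by simp
  rw [← hcard]
  by_cases hab : a = b
  · subst hab
    have h := hκ.integral_norm_sq_mul_norm_sq (glue S a c) (glue S a c')
    simp only [glue_inj, true_and] at h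
    have h2 : ∫ ψ, ψ (glue S a c) * star (ψ (glue S a c)) *
        (star (ψ (glue S a c')) * ψ (glue S a c')) ∂κ =
        ∫ ψ, ((‖ψ (glue S a c)‖ ^ 2 * ‖ψ (glue S a c')‖ ^ 2 : ℝ) : ℂ) ∂κ := by
      refine integral_congr_ae (Filter.Eventually.of_forall fun ψ => ?_)
      simp only [Complex.star_def, Complex.mul_conj', Complex.conj_mul']
      push_cast
      rfl
    rw [h2, integral_complex_ofReal, h]
    congr 2
    by_cases hc : c = c'
    · simp only [hc, if_true]; norm_num
    · simp only [hc, if_true, if_false]; norm_num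
  · by_cases hc : c = c'
    · subst hc
      have h := hκ.integral_norm_sq_mul_norm_sq (glue S a c) (glue S b c)
      simp only [glue_inj, hab, false_and, if_false] at h
      have h2 : ∫ ψ, ψ (glue S a c) * star (ψ (glue S b c)) *
          (star (ψ (glue S a c)) * ψ (glue S b c)) ∂κ =
          ∫ ψ, ((‖ψ (glue S a c)‖ ^ 2 * ‖ψ (glue S b c)‖ ^ 2 : ℝ) : ℂ) ∂κ := by
        refine integral_congr_ae (Filter.Eventually.of_forall fun ψ => ?_)
        push_cast
        rw [← Complex.mul_conj', ← Complex.mul_conj']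
        simp only [Complex.star_def]
        ring
      rw [h2, integral_complex_ofReal, h]
      simp [hab]
    · rw [hκ.integral_eq_zero]
      · simp [hab, hc]
      · simp [glue_inj, hab]
      · simp [glue_inj, hc]
      · simp [glue_inj, hab]

lemma sum_norm_reduced_sq (ψ : H m d) :
    ((∑ a, ∑ b, ‖reduced S ψ a b‖ ^ 2 : ℝ) : ℂ) = ∑ a, ∑ b, ∑ c, ∑ c',
      ψ (glue S a c) * star (ψ (glue S b c)) * (star (ψ (glue S a c')) * ψ (glue S b c')) := by
  push_cast
  refine Finset.sum_congr rfl fun a _ => Finset.sum_congr rfl fun b _ => ?_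
  rw [← Complex.mul_conj']
  simp only [reduced, partialTrace, ketbra, Matrix.of_apply]
  rw [map_sum, Finset.sum_mul_sum]
  simp

/-- The mean purity of a reduced state. -/
lemma IsSphereLaw.integral_purity (hκ : IsSphereLaw κ) :
    ∫ ψ, (∑ a, ∑ b, ‖reduced S ψ a b‖ ^ 2) ∂κ =
      (Fintype.card ({i // i ∈ S} → Fin d) * Fintype.card ({i // i ∉ S} → Fin d) *
        (Fintype.card ({i // i ∈ S} → Fin d) + Fintype.card ({i // i ∉ S} → Fin d))) /
        ((d : ℝ) ^ m * ((d : ℝ) ^ m + 1)) := by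
  apply Complex.ofReal_injective
  rw [← integral_complex_ofReal]
  have hsum : ∫ ψ, ((∑ a, ∑ b, ‖reduced S ψ a b‖ ^ 2 : ℝ) : ℂ) ∂κ = ∑ a, ∑ b, ∑ c, ∑ c',
      ∫ ψ, ψ (glue S a c) * star (ψ (glue S b c)) *
        (star (ψ (glue S a c')) * ψ (glue S b c')) ∂κ := by
    simp_rw [sum_norm_reduced_sq]
    rw [hκ.integral_sum fun a => by fun_prop]
    refine Finset.sum_congr rfl fun a _ => ?_
    rw [hκ.integral_sum fun b => by fun_prop]
    refine Finset.sum_congr rfl fun b _ => ?_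
    rw [hκ.integral_sum fun c => by fun_prop]
    refine Finset.sum_congr rfl fun c _ => ?_
    exact hκ.integral_sum fun c' => by fun_prop
  rw [hsum]
  simp_rw [hκ.integral_glue S]
  simp_rw [← Complex.ofReal_sum]
  congr 1
  simp only [← Finset.sum_div, Finset.sum_add_distrib, Finset.sum_const, Finset.card_univ,
    nsmul_eq_mul, Finset.sum_ite_eq, Finset.mem_univ, if_true, ← Finset.mul_sum, mul_one]
  congr 1
  ring

lemma trace_reduced (ψ : H m d) : ∑ a, reduced S ψ a a = ((‖ψ‖ ^ 2 : ℝ) : ℂ) := by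
  simp only [reduced, partialTrace, ketbra, Matrix.of_apply]
  rw [sum_glue S fun x => ψ x * star (ψ x), EuclideanSpace.norm_sq_eq]
  push_cast
  refine Finset.sum_congr rfl fun x _ => ?_
  rw [← Complex.mul_conj']
  rfl

lemma norm_sub_real_sq (z : ℂ) (r : ℝ) : ‖z - r‖ ^ 2 = ‖z‖ ^ 2 - 2 * r * z.re + r ^ 2 := by
  simp only [Complex.sq_norm, Complex.normSq_apply, Complex.sub_re, Complex.sub_im,
    Complex.ofReal_re, Complex.ofReal_im]
  ring

/-- The squared Hilbert–Schmidt distance to the maximally mixed state is the purity minus `1 / N`,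
because the reduced state has trace one. -/
lemma deviation_sq_le (hd : 0 < d) {ψ : H m d} (hψ : ‖ψ‖ = 1) :
    deviation S ψ ^ 2 ≤
      Fintype.card ({i // i ∈ S} → Fin d) * (∑ a, ∑ b, ‖reduced S ψ a b‖ ^ 2) - 1 := by
  refine (traceNorm_sq_le _).trans_eq ?_
  set N := Fintype.card ({i // i ∈ S} → Fin d) with hN
  have hNd : N = d ^ S.card := card_words S
  have hN0 : (N : ℝ) ≠ 0 := by rw [hNd]; positivity
  have hmix : maxMixed m d S = (((N : ℝ)⁻¹ : ℝ) : ℂ) • 1 := by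
    rw [maxMixed, hNd]; push_cast; rfl
  have hentry : ∀ a b, ‖(reduced S ψ - ((‖ψ‖ ^ 2 : ℝ) : ℂ) • maxMixed m d S) a b‖ ^ 2 =
      ‖reduced S ψ a b‖ ^ 2 +
        if a = b then (N : ℝ)⁻¹ ^ 2 - 2 * (N : ℝ)⁻¹ * (reduced S ψ a a).re else 0 := by
    intro a b
    rw [hmix, hψ]
    by_cases h : a = b
    · subst h
      simp only [Matrix.sub_apply, Matrix.smul_apply, Matrix.one_apply_eq, if_true, smul_eq_mul,
        mul_one, one_pow, Complex.ofReal_one, one_mul]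
      rw [norm_sub_real_sq]
      ring
    · simp [Matrix.one_apply_ne h, h]
  simp_rw [hentry, Finset.sum_add_distrib]
  simp only [Finset.sum_ite_eq, Finset.mem_univ, if_true, Finset.sum_sub_distrib, Finset.sum_const,
    Finset.card_univ, nsmul_eq_mul, ← Finset.mul_sum]
  have htr := congrArg Complex.re (trace_reduced S ψ)
  rw [Complex.re_sum, Complex.ofReal_re, hψ] at htr
  rw [htr, ← hN]
  field_simp
  ring

/-- The mean deviation of a reduced state from the maximally mixed state. -/
lemma IsSphereLaw.lintegral_deviation_le (hκ : IsSphereLaw κ) (hd : 0 < d) :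
    ∫⁻ ψ, ENNReal.ofReal (deviation S ψ) ∂κ ≤
      ENNReal.ofReal ((d : ℝ) ^ ((S.card : ℝ) - (m : ℝ) / 2)) := by
  have := hκ.prob
  have hc := continuous_deviation (m := m) S hd
  have hi := hκ.integrable hc
  rw [← ofReal_integral_eq_lintegral_ofReal hi
    (Filter.Eventually.of_forall fun ψ => deviation_nonneg S ψ)]
  refine ENNReal.ofReal_le_ofReal ?_
  have hcp : Continuous fun ψ : H m d => ∑ a, ∑ b, ‖reduced S ψ a b‖ ^ 2 := by
    simp only [reduced, partialTrace, ketbra, Matrix.of_apply]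
    fun_prop
  have hd' : (0 : ℝ) < d := by exact_mod_cast hd
  set N : ℝ := ((Fintype.card ({i // i ∈ S} → Fin d) : ℕ) : ℝ) with hN
  set N' : ℝ := ((Fintype.card ({i // i ∉ S} → Fin d) : ℕ) : ℝ) with hN'
  have hND : N * N' = (d : ℝ) ^ m := by rw [hN, hN']; exact_mod_cast card_words_mul S
  have hNd : N = (d : ℝ) ^ S.card := by rw [hN, card_words]; push_cast; rfl
  have hJ : (∫ ψ, deviation S ψ ∂κ) ^ 2 ≤ ∫ ψ, deviation S ψ ^ 2 ∂κ := by
    have := (even_two.convexOn_pow (𝕜 := ℝ)).map_integral_le (μ := κ) (f := deviation S)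
      (continuous_pow 2).continuousOn isClosed_univ
      (Filter.Eventually.of_forall fun _ => Set.mem_univ _) hi (hκ.integrable (hc.pow 2))
    exact this
  have h2 : ∫ ψ, deviation S ψ ^ 2 ∂κ ≤ N ^ 2 / (d : ℝ) ^ m := by
    calc ∫ ψ, deviation S ψ ^ 2 ∂κ
        ≤ ∫ ψ, (N * (∑ a, ∑ b, ‖reduced S ψ a b‖ ^ 2) - 1) ∂κ := by
          refine integral_mono_ae (hκ.integrable (hc.pow 2)) (hκ.integrable (by fun_prop)) ?_
          filter_upwards [hκ.norm_eq_one] with ψ hψ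
          exact deviation_sq_le S hd hψ
      _ = N * ((N * N' * (N + N')) / ((d : ℝ) ^ m * ((d : ℝ) ^ m + 1))) - 1 := by
          rw [integral_sub (hκ.integrable (by fun_prop)) (integrable_const _), integral_const_mul,
            hκ.integral_purity S, integral_const, probReal_univ, one_smul]
      _ ≤ _ := by
          have hD : (0 : ℝ) < (d : ℝ) ^ m := by positivity
          have h3 : N * ((N * N' * (N + N')) / ((d : ℝ) ^ m * ((d : ℝ) ^ m + 1))) - 1 =
              (N ^ 2 - 1) / ((d : ℝ) ^ m + 1) := by
            rw [hND]
            have : N * (N + N') = N ^ 2 + (d : ℝ) ^ m := by rw [← hND]; ring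
            field_simp
            linarith
          rw [h3]
          refine div_le_div₀ (sq_nonneg _) (by linarith) hD (by linarith)
  have h4 : N ^ 2 / (d : ℝ) ^ m = ((d : ℝ) ^ ((S.card : ℝ) - (m : ℝ) / 2)) ^ 2 := by
    rw [hNd, ← rpow_natCast, ← rpow_natCast, ← rpow_natCast, ← rpow_natCast, ← rpow_mul hd'.le,
      ← rpow_mul hd'.le, ← rpow_sub hd']
    congr 1
    push_cast
    ring
  rw [h4] at h2
  exact (pow_le_pow_iff_left₀ (integral_nonneg fun ψ => deviation_nonneg S ψ) (by positivity)
    two_ne_zero).mp (hJ.trans h2)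

end SecondMoment

/-! ### Nets of the unit sphere -/

/-- Volume comparison: disjoint balls of radius `ε / 2` inside a ball of radius `1 + ε / 2`. -/
lemma card_le_of_separated {E : Type*} [NormedAddCommGroup E] [NormedSpace ℝ E]
    [FiniteDimensional ℝ E] {ε : ℝ} (hε : 0 < ε) (s : Finset E) (hs : ∀ c ∈ s, ‖c‖ ≤ 1)
    (h : ∀ c ∈ s, ∀ e ∈ s, c ≠ e → ε ≤ ‖c - e‖) :
    (s.card : ℝ) ≤ (1 + 2 / ε) ^ Module.finrank ℝ E := by
  borelize E
  let μ : Measure E := Measure.addHaar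
  set δ : ℝ := ε / 2 with hδ_def
  set ρ : ℝ := 1 + ε / 2 with hρ_def
  have hδ : 0 < δ := by positivity
  have hρ : 0 < ρ := by positivity
  have hdisj : Set.Pairwise (s : Set E) (Function.onFun Disjoint fun c => Metric.ball (c : E) δ) := by
    rintro c hc e he hce
    apply Metric.ball_disjoint_ball
    rw [dist_eq_norm]
    linarith [h c hc e he hce]
  have hsub : (⋃ c ∈ s, Metric.ball (c : E) δ) ⊆ Metric.ball (0 : E) ρ := by
    refine Set.iUnion₂_subset fun x hx => Metric.ball_subset_ball' ?_
    rw [dist_zero_right]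
    linarith [hs x hx]
  have hvol : (s.card : ℝ≥0∞) * ENNReal.ofReal (δ ^ Module.finrank ℝ E) * μ (Metric.ball 0 1) ≤
      ENNReal.ofReal (ρ ^ Module.finrank ℝ E) * μ (Metric.ball 0 1) := by
    calc _ = μ (⋃ c ∈ s, Metric.ball (c : E) δ) := by
          rw [measure_biUnion_finset hdisj fun c _ => measurableSet_ball]
          simp only [μ.addHaar_ball_of_pos _ hδ, Finset.sum_const, nsmul_eq_mul, mul_assoc]
      _ ≤ μ (Metric.ball (0 : E) ρ) := measure_mono hsub
      _ = _ := by rw [μ.addHaar_ball_of_pos _ hρ]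
  have hcard : (s.card : ℝ≥0∞) * ENNReal.ofReal (δ ^ Module.finrank ℝ E) ≤
      ENNReal.ofReal (ρ ^ Module.finrank ℝ E) :=
    (ENNReal.mul_le_mul_iff_left (Metric.measure_ball_pos _ _ zero_lt_one).ne'
      measure_ball_lt_top.ne).1 hvol
  have hreal := ENNReal.toReal_le_of_le_ofReal (pow_nonneg hρ.le _) hcard
  rw [ENNReal.toReal_mul, ENNReal.toReal_natCast, ENNReal.toReal_ofReal (by positivity)] at hreal
  have hratio : 1 + 2 / ε = ρ / δ := by rw [hρ_def, hδ_def]; field_simp; ring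
  rw [hratio, div_pow, le_div_iff₀ (by positivity)]
  exact hreal

/-- A separated subset of the sphere of maximal cardinality is a net. The exponent is the real
dimension. -/
lemma exists_sphere_net {E : Type*} [NormedAddCommGroup E] [NormedSpace ℂ E]
    [FiniteDimensional ℂ E] {ε : ℝ} (hε : 0 < ε) :
    ∃ s : Finset E, (∀ c ∈ s, ‖c‖ = 1) ∧ (∀ x : E, ‖x‖ = 1 → ∃ c ∈ s, ‖x - c‖ ≤ ε) ∧
      (s.card : ℝ) ≤ (1 + 2 / ε) ^ (2 * Module.finrank ℂ E) := by
  classical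
  let P : Finset E → Prop := fun s =>
    (∀ c ∈ s, ‖c‖ = 1) ∧ ∀ c ∈ s, ∀ e ∈ s, c ≠ e → ε ≤ ‖c - e‖
  have hbound : ∀ s, P s → (s.card : ℝ) ≤ (1 + 2 / ε) ^ (2 * Module.finrank ℂ E) := by
    intro s hs
    rw [← finrank_real_of_complex]
    exact card_le_of_separated hε s (fun c hc => (hs.1 c hc).le) hs.2
  let T : Set ℕ := {n | ∃ s, P s ∧ s.card = n}
  have hT : T.Nonempty := ⟨0, ∅, ⟨by simp, by simp⟩, rfl⟩
  have hTb : BddAbove T := by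
    refine ⟨⌈(1 + 2 / ε) ^ (2 * Module.finrank ℂ E)⌉₊, ?_⟩
    rintro _ ⟨s, hs, rfl⟩
    exact_mod_cast (hbound s hs).trans (Nat.le_ceil _)
  obtain ⟨s, hs, hcard⟩ := Nat.sSup_mem hT hTb
  refine ⟨s, hs.1, fun x hx => ?_, hbound s hs⟩
  by_contra! hfar
  have hxs : x ∉ s := fun hmem => by
    have := hfar x hmem
    rw [sub_self, norm_zero] at this
    linarith
  have hins : P (insert x s) := by
    refine ⟨fun c hc => ?_, fun c hc e he hce => ?_⟩
    · rcases Finset.mem_insert.mp hc with rfl | hc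
      · exact hx
      · exact hs.1 c hc
    · rcases Finset.mem_insert.mp hc with rfl | hc'
      · rcases Finset.mem_insert.mp he with rfl | he'
        · exact absurd rfl hce
        · exact (hfar e he').le
      · rcases Finset.mem_insert.mp he with rfl | he'
        · rw [norm_sub_rev]; exact (hfar c hc').le
        · exact hs.2 c hc' e he' hce
  have hle := le_csSup hTb ⟨_, hins, rfl⟩
  rw [Finset.card_insert_of_notMem hxs, hcard] at hle
  omega

/-! ### Haar random unitaries -/

/-- Lévy's lemma on the unit sphere of a complex Hilbert space. -/
lemma complex_sphere_concentration {E : Type*} [NormedAddCommGroup E] [InnerProductSpace ℂ E]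
    [FiniteDimensional ℂ E] [MeasurableSpace E] [BorelSpace E]
    {Ω : Type*} [MeasurableSpace Ω] {ν : Measure Ω} [IsProbabilityMeasure ν]
    {V : Ω → E ≃ₗᵢ[ℂ] E} (hVm : Measurable fun p : Ω × E => V p.1 p.2)
    {κ : Measure E} (hκ : ∀ ψ : E, ‖ψ‖ = 1 → ν.map (fun ω => V ω ψ) = κ)
    (hn : 2 ≤ Module.finrank ℂ E)
    {f : E → ℝ} (hf0 : ∀ x, 0 ≤ f x) (hfs : ∀ (c : ℝ) x, f ((c : ℂ) • x) = c ^ 2 * f x)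
    (hfc : Continuous f)
    (hfl : ∀ x y, ‖x‖ ≤ 1 → ‖y‖ ≤ 1 → |f x - f y| ≤ 4 * ‖x - y‖)
    {M : ℝ} (hM0 : 0 ≤ M) (hM : ∫⁻ x, ENNReal.ofReal (f x) ∂κ ≤ ENNReal.ofReal M)
    {s : ℝ} (hs : 0 ≤ s) :
    κ {x | M + s ≤ f x} ≤
      ENNReal.ofReal (2 * exp (-(Module.finrank ℂ E * s ^ 2 / (32 * π ^ 2)))) := by
  let _ : InnerProductSpace ℝ E := InnerProductSpace.complexToReal
  have hdim : Module.finrank ℝ E = 2 * Module.finrank ℂ E := finrank_real_of_complex E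
  let W : Ω → E ≃ₗᵢ[ℝ] E := fun ω =>
    { toLinearEquiv := (V ω).toLinearEquiv.restrictScalars ℝ, norm_map' := (V ω).norm_map }
  have h := sphere_concentration (U := fun ω x => V ω x) hVm
    (fun ω => stdGaussian_map (W ω)) (fun ω x => (V ω).norm_map x)
    (fun ω c x => (W ω).map_smul c x) hκ (by omega) hf0
    (fun c x => hfs c x) hfc hfl hM0 hM hs
  refine h.trans_eq ?_
  -- The real dimension is twice the complex one, which turns 64 into 32.
  rw [hdim]
  congr 3
  push_cast
  have := pi_pos
  field_simp
  ring

section Haar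
variable {m d : ℕ}

instance : ContinuousStar (H m d →L[ℂ] H m d) :=
  ⟨(ContinuousLinearMap.adjoint (𝕜 := ℂ) (E := H m d) (F := H m d)).continuous⟩

instance : SecondCountableTopology (H m d →L[ℂ] H m d) :=
  have : ProperSpace (H m d →L[ℂ] H m d) := FiniteDimensional.proper_rclike ℂ _
  inferInstance

instance : CompactSpace (UG m d) := by
  refine (isCompact_iff_compactSpace
    (s := ((unitary (H m d →L[ℂ] H m d) : Submonoid _) : Set (H m d →L[ℂ] H m d)))).mp ?_
  have : ProperSpace (H m d →L[ℂ] H m d) := FiniteDimensional.proper_rclike ℂ _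
  refine Metric.isCompact_of_isClosed_isBounded isClosed_unitary ?_
  refine (Metric.isBounded_closedBall (x := (0 : H m d →L[ℂ] H m d)) (r := 1)).subset ?_
  intro g hg
  rw [mem_closedBall_zero_iff]
  refine ContinuousLinearMap.opNorm_le_bound _ zero_le_one fun x => ?_
  have := (Unitary.linearIsometryEquiv ⟨g, hg⟩).norm_map x
  rw [one_mul]
  exact this.le

lemma continuous_unitary_apply :
    Continuous fun p : UG m d × H m d => Unitary.linearIsometryEquiv p.1 p.2 := by
  change Continuous fun p : UG m d × H m d => (p.1 : H m d →L[ℂ] H m d) p.2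
  fun_prop

/-- The Haar probability measure of the unitary group. -/
def haarUG (m d : ℕ) : Measure (UG m d) := Measure.haarMeasure ⊤

instance : IsProbabilityMeasure (haarUG m d) := ⟨by
  have := Measure.haarMeasure_self (G := UG m d) (K₀ := ⊤)
  simpa [haarUG] using this⟩

instance : Measure.IsHaarMeasure (haarUG m d) := by unfold haarUG; infer_instance

/-- A right translate is again a left Haar probability measure, so uniqueness applies. Right
invariance makes the law of `g ψ` independent of the unit vector `ψ`; left invariance makes it
unitarily invariant. -/
lemma haarUG_map_mul_right (g : UG m d) : (haarUG m d).map (· * g) = haarUG m d := by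
  have hm : Measurable fun h : UG m d => h * g := measurable_mul_const g
  have : IsProbabilityMeasure ((haarUG m d).map (· * g)) :=
    Measure.isProbabilityMeasure_map hm.aemeasurable
  exact Measure.isHaarMeasure_eq_of_isProbabilityMeasure _ _

/-- The law of a Haar random unit vector. -/
def haarSphere (ψ : H m d) : Measure (H m d) :=
  (haarUG m d).map fun g => Unitary.linearIsometryEquiv g ψ

lemma measurable_unitary_apply (ψ : H m d) :
    Measurable fun g : UG m d => Unitary.linearIsometryEquiv g ψ :=
  (continuous_unitary_apply.comp (continuous_id.prodMk continuous_const)).measurable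

lemma haarSphere_eq {ψ φ : H m d} (hψ : ‖ψ‖ = 1) (hφ : ‖φ‖ = 1) :
    haarSphere ψ = haarSphere φ := by
  obtain ⟨V, hV⟩ := exists_linearIsometryEquiv_apply_eq hφ hψ
  obtain ⟨g, rfl⟩ := Unitary.linearIsometryEquiv.surjective V
  rw [haarSphere, haarSphere]
  conv_rhs => rw [← haarUG_map_mul_right g]
  rw [Measure.map_map (measurable_unitary_apply φ) (measurable_mul_const g)]
  congr 1
  funext h
  simp [← hV]

lemma isSphereLaw_haarSphere {ψ : H m d} (hψ : ‖ψ‖ = 1) : IsSphereLaw (haarSphere ψ) where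
  prob := Measure.isProbabilityMeasure_map (measurable_unitary_apply ψ).aemeasurable
  norm_eq_one := by
    rw [haarSphere, ae_map_iff (measurable_unitary_apply ψ).aemeasurable
      (measurableSet_eq_fun measurable_norm measurable_const)]
    exact Filter.Eventually.of_forall fun g => by rw [LinearIsometryEquiv.norm_map, hψ]
  map_eq V := by
    obtain ⟨g, rfl⟩ := Unitary.linearIsometryEquiv.surjective V
    rw [haarSphere, Measure.map_map (LinearIsometryEquiv.continuous _).measurable
      (measurable_unitary_apply ψ)]
    conv_rhs => rw [← map_mul_left_eq_self (haarUG m d) g]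
    rw [Measure.map_map (measurable_unitary_apply ψ) (measurable_const_mul g)]
    congr 1

/-- Concentration of the deviation of the reduced state of a Haar random unit vector. -/
lemma haarUG_deviation_ge_le (hd : 2 ≤ d) (hm : 1 ≤ m) (S : Finset (Fin m)) {ψ : H m d}
    (hψ : ‖ψ‖ = 1) {s : ℝ} (hs : 0 ≤ s) :
    haarUG m d {g | (d : ℝ) ^ ((S.card : ℝ) - (m : ℝ) / 2) + s ≤
      deviation S (Unitary.linearIsometryEquiv g ψ)} ≤
      ENNReal.ofReal (2 * exp (-((d : ℝ) ^ m * s ^ 2 / (32 * π ^ 2)))) := by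
  have hd0 : 0 < d := by omega
  have hdim : Module.finrank ℂ (H m d) = d ^ m := by simp
  have hD : 2 ≤ Module.finrank ℂ (H m d) := by
    rw [hdim]
    exact hd.trans (Nat.le_self_pow (by omega) d)
  have h := complex_sphere_concentration (κ := haarSphere ψ)
    (V := fun g : UG m d => Unitary.linearIsometryEquiv g) (ν := haarUG m d)
    continuous_unitary_apply.measurable (fun φ hφ => haarSphere_eq hφ hψ) hD
    (deviation_nonneg S) (deviation_smul S) (continuous_deviation S hd0)
    (fun x y hx hy => abs_deviation_sub_le_four S hd0 hx hy) (by positivity)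
    ((isSphereLaw_haarSphere hψ).lintegral_deviation_le S hd0) hs
  rw [haarSphere, Measure.map_apply (measurable_unitary_apply ψ)
    (measurableSet_le measurable_const (continuous_deviation S hd0).measurable), hdim] at h
  push_cast at h
  exact h

end Haar

/-! ### Random subspaces -/

section Grassmannian
variable {m d dC : ℕ}

instance : SecondCountableTopology (Gr m d dC) :=
  TopologicalSpace.secondCountableTopology_induced _ _ _

lemma continuous_starProjection : Continuous fun C : Gr m d dC => C.1.starProjection :=
  continuous_induced_dom

lemma continuous_rotate_prod :
    Continuous fun p : UG m d × Gr m d dC => Gr.rotate (Unitary.linearIsometryEquiv p.1) p.2 := by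
  rw [continuous_induced_rng]
  have h : ((fun C : Gr m d dC => C.1.starProjection) ∘ fun p : UG m d × Gr m d dC =>
      Gr.rotate (Unitary.linearIsometryEquiv p.1) p.2) = fun p =>
        (p.1 : H m d →L[ℂ] H m d) * p.2.1.starProjection * star (p.1 : H m d →L[ℂ] H m d) := by
    funext p
    ext1 x
    exact Submodule.starProjection_map_apply (Unitary.linearIsometryEquiv p.1) p.2.1 x
  rw [h]
  have h1 : Continuous fun p : UG m d × Gr m d dC => p.2.1.starProjection :=
    continuous_starProjection.comp continuous_snd
  fun_prop

/-- An invariant law on the Grassmannian is the mixture of the laws of the Haar random rotations of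
its points. -/
lemma IsUniform.measure_eq {μ : Measure (Gr m d dC)} (hμ : IsUniform μ) {A : Set (Gr m d dC)}
    (hA : MeasurableSet A) :
    μ A = ∫⁻ C, haarUG m d {g | Gr.rotate (Unitary.linearIsometryEquiv g) C ∈ A} ∂μ := by
  have := hμ.prob
  have hind : Measurable fun p : UG m d × Gr m d dC =>
      A.indicator (1 : Gr m d dC → ℝ≥0∞) (Gr.rotate (Unitary.linearIsometryEquiv p.1) p.2) :=
    (measurable_one.indicator hA).comp continuous_rotate_prod.measurable
  calc μ A = ∫⁻ _g, μ A ∂(haarUG m d) := by simp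
    _ = ∫⁻ g, (∫⁻ C, A.indicator (1 : Gr m d dC → ℝ≥0∞)
          (Gr.rotate (Unitary.linearIsometryEquiv g) C) ∂μ) ∂(haarUG m d) := by
        refine lintegral_congr fun g => ?_
        conv_lhs => rw [← hμ.invariant (Unitary.linearIsometryEquiv g), ← lintegral_indicator_one hA]
        exact lintegral_map (measurable_one.indicator hA) (Gr.continuous_rotate _).measurable
    _ = ∫⁻ C, (∫⁻ g, A.indicator (1 : Gr m d dC → ℝ≥0∞)
          (Gr.rotate (Unitary.linearIsometryEquiv g) C) ∂(haarUG m d)) ∂μ :=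
        lintegral_lintegral_swap hind.aemeasurable
    _ = _ := by
        refine lintegral_congr fun C => ?_
        exact lintegral_indicator_one ((Gr.continuous_rotate_left C).measurable hA)

/-- The subspaces that contain a unit vector of deviation larger than `T` on `S`. -/
def badSubspaces (dC : ℕ) (S : Finset (Fin m)) (T : ℝ) : Set (Gr m d dC) :=
  {C | ∃ ψ ∈ C.1, ‖ψ‖ = 1 ∧ T < deviation S ψ}

/-- Needed for measurability. Each `φ` is projected to the subspace, which depends continuously on
the subspace, and homogeneity expresses the condition without normalising the projection. -/
lemma isOpen_badSubspaces (hd : 0 < d) (S : Finset (Fin m)) (T : ℝ) :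
    IsOpen (badSubspaces (d := d) dC S T) := by
  have hset : badSubspaces (d := d) dC S T = ⋃ φ : H m d, {C : Gr m d dC |
      T * ‖C.1.starProjection φ‖ ^ 2 < deviation S (C.1.starProjection φ) ∧
        C.1.starProjection φ ≠ 0} := by
    ext C
    simp only [badSubspaces, Set.mem_ofPred_eq, Set.mem_iUnion]
    constructor
    · rintro ⟨ψ, hψC, hψ, hT⟩
      have hp : C.1.starProjection ψ = ψ := Submodule.starProjection_eq_self_iff.mpr hψC
      refine ⟨ψ, ?_, ?_⟩
      · rw [hp, hψ]; simpa using hT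
      · rw [hp]; intro h0; rw [h0, norm_zero] at hψ; exact zero_ne_one hψ
    · rintro ⟨φ, hT, hne⟩
      set y := C.1.starProjection φ with hy
      have hyC : y ∈ C.1 := Submodule.starProjection_apply_mem _ _
      have hy0 : 0 < ‖y‖ := norm_pos_iff.mpr hne
      refine ⟨(((‖y‖)⁻¹ : ℝ) : ℂ) • y, C.1.smul_mem _ hyC, ?_, ?_⟩
      · rw [norm_smul, Complex.norm_real, norm_inv, norm_norm, inv_mul_cancel₀ hy0.ne']
      · rw [deviation_smul, inv_pow, ← div_eq_inv_mul, lt_div_iff₀ (by positivity)]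
        exact hT
  rw [hset]
  refine isOpen_iUnion fun φ => ?_
  have hc : Continuous fun C : Gr m d dC => C.1.starProjection φ :=
    continuous_starProjection.clm_apply continuous_const
  exact (isOpen_lt (by fun_prop) ((continuous_deviation S hd).comp hc)).inter
    (isOpen_ne_fun hc continuous_const)

lemma haarUG_rotate_mem_badSubspaces_le (hd : 2 ≤ d) (hm : 1 ≤ m) (S : Finset (Fin m))
    (C : Gr m d dC) {α : ℝ} (hα : 0 < α) (hα2 : α ≤ 2) :
    haarUG m d {g | Gr.rotate (Unitary.linearIsometryEquiv g) C ∈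
      badSubspaces dC S ((d : ℝ) ^ ((S.card : ℝ) - (m : ℝ) / 2) + α)} ≤
      ENNReal.ofReal ((10 / α) ^ (2 * dC) *
        (2 * exp (-((d : ℝ) ^ m * (α / 2) ^ 2 / (32 * π ^ 2))))) := by
  have hd0 : 0 < d := by omega
  obtain ⟨N, hN1, hNcov, hNcard⟩ := exists_sphere_net (E := C.1) (ε := α / 4) (by positivity)
  rw [C.2] at hNcard
  set M := (d : ℝ) ^ ((S.card : ℝ) - (m : ℝ) / 2)
  have hsub : {g | Gr.rotate (Unitary.linearIsometryEquiv g) C ∈ badSubspaces dC S (M + α)} ⊆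
      ⋃ φ ∈ N, {g : UG m d | M + α / 2 ≤
        deviation S (Unitary.linearIsometryEquiv g (φ : H m d))} := by
    rintro g ⟨ψ', hψ'mem, hψ', hT⟩
    obtain ⟨ψ, hψC, hgψ⟩ := Submodule.mem_map.mp hψ'mem
    replace hgψ : Unitary.linearIsometryEquiv g ψ = ψ' := hgψ
    have hψ : ‖ψ‖ = 1 := by rw [← hψ', ← hgψ, LinearIsometryEquiv.norm_map]
    obtain ⟨φ, hφN, hφ⟩ := hNcov ⟨ψ, hψC⟩ hψ
    refine Set.mem_biUnion hφN ?_
    have hφ' : ‖ψ - (φ : H m d)‖ ≤ α / 4 := hφ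
    have hφ1 : ‖(φ : H m d)‖ = 1 := hN1 φ hφN
    -- Both vectors are unit vectors at distance at most `α / 4`, so the deviation drops by at most
    -- `α / 2`.
    have h := deviation_sub_le S hd0 ψ' (Unitary.linearIsometryEquiv g (φ : H m d))
    rw [← hgψ, ← map_sub] at h
    simp only [LinearIsometryEquiv.norm_map, hψ, hφ1, sub_self, abs_zero] at h
    rw [← hgψ] at hT
    change M + α / 2 ≤ deviation S _
    linarith
  calc _ ≤ ∑ φ ∈ N, haarUG m d {g : UG m d | M + α / 2 ≤
        deviation S (Unitary.linearIsometryEquiv g (φ : H m d))} :=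
        (measure_mono hsub).trans (measure_biUnion_finset_le _ _)
    _ ≤ ∑ _φ ∈ N, ENNReal.ofReal (2 * exp (-((d : ℝ) ^ m * (α / 2) ^ 2 / (32 * π ^ 2)))) :=
        Finset.sum_le_sum fun φ hφ => haarUG_deviation_ge_le hd hm S (hN1 φ hφ) (by positivity)
    _ = ENNReal.ofReal (N.card * (2 * exp (-((d : ℝ) ^ m * (α / 2) ^ 2 / (32 * π ^ 2))))) := by
        rw [Finset.sum_const, nsmul_eq_mul, ENNReal.ofReal_mul (Nat.cast_nonneg _),
          ENNReal.ofReal_natCast]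
    _ ≤ _ := by
        refine ENNReal.ofReal_le_ofReal (mul_le_mul_of_nonneg_right ?_ (by positivity))
        -- Here `1 + 8 / α ≤ 10 / α`, which is where `α ≤ 2` enters.
        refine hNcard.trans (pow_le_pow_left₀ (by positivity) ?_ _)
        rw [le_div_iff₀ hα]
        have : (1 + 2 / (α / 4)) * α = α + 8 := by field_simp; ring
        linarith

lemma IsUniform.badSubspaces_le {μ : Measure (Gr m d dC)} (hμ : IsUniform μ) (hd : 2 ≤ d)
    (hm : 1 ≤ m) (S : Finset (Fin m)) {α : ℝ} (hα : 0 < α) (hα2 : α ≤ 2) :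
    μ.real (badSubspaces dC S ((d : ℝ) ^ ((S.card : ℝ) - (m : ℝ) / 2) + α)) ≤
      (10 / α) ^ (2 * dC) * (2 * exp (-((d : ℝ) ^ m * (α / 2) ^ 2 / (32 * π ^ 2)))) := by
  have := hμ.prob
  refine ENNReal.toReal_le_of_le_ofReal (by positivity) ?_
  rw [hμ.measure_eq (isOpen_badSubspaces (by omega) S _).measurableSet]
  refine (lintegral_mono fun C => haarUG_rotate_mem_badSubspaces_le hd hm S C hα hα2).trans ?_
  simp

/-- `0 ≤ T` covers the default value 0 of a real supremum over an empty family. -/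
lemma inaccuracy_le {C : Gr m d dC} {k : ℕ} {T : ℝ} (hT : 0 ≤ T)
    (h : ∀ S : Finset (Fin m), S.card = k → C ∉ badSubspaces dC S T) :
    inaccuracy (pureStates C.1) k ≤ T := by
  refine Real.iSup_le (fun S => Real.iSup_le (fun ψ => ?_) hT) hT
  have hψ := ψ.2
  rw [← deviation_eq_traceDist S.1 hψ.2]
  by_contra! hlt
  exact h S.1 S.2 ⟨ψ, hψ.1, hψ.2, hlt⟩

end Grassmannian

end

end QMask

/-! ### Union bound over subsystems and comparison of constants -/

theorem theorem6 (m d k dC : ℕ) (hd : 2 ≤ d) (hk : 1 ≤ k) (hkm : k ≤ m) (hdC : 1 ≤ dC)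
    (μ : MeasureTheory.Measure (QMask.Gr m d dC)) (hμ : QMask.IsUniform μ)
    (α : ℝ) (hα : 0 < α) :
    1 - 2 * (m.choose k : ℝ) * (10 / α) ^ (2 * dC)
        * Real.exp (-((d : ℝ) ^ m * α ^ 2 / (72 * Real.pi ^ 3 * Real.log 2)))
      ≤ μ.real {C | QMask.inaccuracy (QMask.pureStates C.1) k
          ≤ (d : ℝ) ^ ((k : ℝ) - (m : ℝ) / 2) + α} := by
  have := hμ.prob
  have hd0 : 0 < d := by omega
  have hm : 1 ≤ m := hk.trans hkm
  set T := (d : ℝ) ^ ((k : ℝ) - (m : ℝ) / 2) + α with hT_def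
  have hM : 0 ≤ (d : ℝ) ^ ((k : ℝ) - (m : ℝ) / 2) := by positivity
  have hT : 0 ≤ T := by positivity
  set good := {C : QMask.Gr m d dC | QMask.inaccuracy (QMask.pureStates C.1) k ≤ T}
  have hbad : goodᶜ ⊆ ⋃ S ∈ (Finset.univ : Finset (Fin m)).powersetCard k,
      QMask.badSubspaces dC S T := by
    intro C hC
    by_contra hno
    refine hC (QMask.inaccuracy_le hT fun S hS hmem => hno ?_)
    exact Set.mem_biUnion (Finset.mem_powersetCard.mpr ⟨Finset.subset_univ S, hS⟩) hmem
  -- Subadditivity alone is used, so `good` need not be shown measurable.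
  have hone : 1 ≤ μ.real good + μ.real goodᶜ := by
    have h := MeasureTheory.measureReal_union_le (μ := μ) good goodᶜ
    rwa [Set.union_compl_self, MeasureTheory.probReal_univ] at h
  suffices h : μ.real goodᶜ ≤ 2 * (m.choose k : ℝ) * (10 / α) ^ (2 * dC)
      * Real.exp (-((d : ℝ) ^ m * α ^ 2 / (72 * Real.pi ^ 3 * Real.log 2))) by linarith
  rcases le_or_gt α 2 with hα2 | hα2
  -- The rate obtained, `1 / (128 π²)`, is better than the claimed one because `72 π log 2 > 128`.
  · have hexp : Real.exp (-((d : ℝ) ^ m * (α / 2) ^ 2 / (32 * Real.pi ^ 2))) ≤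
        Real.exp (-((d : ℝ) ^ m * α ^ 2 / (72 * Real.pi ^ 3 * Real.log 2))) := by
      rw [Real.exp_le_exp, neg_le_neg_iff]
      have hpi := Real.pi_gt_three
      have hlog := Real.log_two_gt_d9
      have h1 : (d : ℝ) ^ m * (α / 2) ^ 2 / (32 * Real.pi ^ 2) =
          (d : ℝ) ^ m * α ^ 2 / (128 * Real.pi ^ 2) := by field_simp; norm_num
      rw [h1]
      refine div_le_div_of_nonneg_left (by positivity) (by positivity) ?_
      have h2 : 128 ≤ 72 * Real.pi * Real.log 2 := by nlinarith
      have h3 := mul_le_mul_of_nonneg_right h2 (sq_nonneg Real.pi)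
      linarith
    calc μ.real goodᶜ
        ≤ μ.real (⋃ S ∈ (Finset.univ : Finset (Fin m)).powersetCard k,
          QMask.badSubspaces dC S T) := MeasureTheory.measureReal_mono hbad (MeasureTheory.measure_ne_top _ _)
      _ ≤ ∑ S ∈ (Finset.univ : Finset (Fin m)).powersetCard k,
          μ.real (QMask.badSubspaces dC S T) := MeasureTheory.measureReal_biUnion_finset_le _ _
      _ ≤ ∑ _S ∈ (Finset.univ : Finset (Fin m)).powersetCard k, (10 / α) ^ (2 * dC) *
          (2 * Real.exp (-((d : ℝ) ^ m * α ^ 2 / (72 * Real.pi ^ 3 * Real.log 2)))) := by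
          refine Finset.sum_le_sum fun S hS => ?_
          have hcard := (Finset.mem_powersetCard.mp hS).2
          have h := hμ.badSubspaces_le hd hm S hα hα2
          rw [hcard] at h
          refine h.trans ?_
          gcongr
      _ = _ := by
          rw [Finset.sum_const, Finset.card_powersetCard, Finset.card_univ, Fintype.card_fin,
            nsmul_eq_mul]
          ring
  · have hempty : goodᶜ = ∅ := by
      rw [Set.compl_empty_iff, Set.eq_univ_iff_forall]
      intro C
      refine QMask.inaccuracy_le hT fun S _ => ?_
      rintro ⟨ψ, _, hψ, hlt⟩
      have h := QMask.deviation_le S hd0 ψ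
      rw [hψ] at h
      linarith
    rw [hempty, MeasureTheory.measureReal_empty]
    have := Real.exp_pos (-((d : ℝ) ^ m * α ^ 2 / (72 * Real.pi ^ 3 * Real.log 2)))
    positivity
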